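/- Let $M$ be a connected smooth (second countable, Hausdorff) manifold, $h$ a smooth Riemannian metric and $\omega$ a smooth 1-form on $M$, $\pi_M,t$ the projections of $V=\mathbb R\times M$, and $\alpha:\mathbb R\to(0,\infty)$ smooth. For a smooth function $\tilde\alpha:\mathbb R\to(0,\infty)$ put $$g_{\tilde\alpha}=-dt^2+\tilde\alpha(t)\,(\pi_M^*\omega\otimes dt+dt\otimes\pi_M^*\omega)+\tilde\alpha(t)^2\,\pi_M^*h,\qquad g_{cl}=g_{1},\quad g_{op}=g_{\alpha}.$$ Let $g=-dt^2+\omega_t\otimes dt+dt\otimes\omega_t+h_t$ on $V$, where $\omega_t$ is a smooth 1-form on $V$ with $\omega_t(\partial_t)=0$ and $h_t$ is a family of Riemannian metrics on $M$ depending smoothly on $t\in\mathbb R$. All these metrics are time-oriented by $\partial_t$. Write $g\prec_0 g'$ if every future-directed causal vector of $g$ is a future-directed causal vector of $g'$. For a metric $g$ on $V$ let $I^-(A)$ be the set of points from which a future-directed timelike curve leads to a point of $A$; a past set is a non-empty $P\subset V$ with $I^-(P)=P$; it is indecomposable (an IP) if it is not the union of two past sets that are proper subsets of it; and $\hat V$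 is the set of all IPs for $g$, $\hat V_{cl}$ the set of all IPs for $g_{cl}$. Let $F^+(v)=\sqrt{h(v,v)+\omega(v)^2}+\omega(v)$, and let $d^+(x,y)$ be the infimum of the $F^+$-lengths of the piecewise smooth curves from $x$ to $y$. Let $B^+(M)$ be the set of all functions $b:M\to\mathbb R$ of the form $b(x)=\lim_{t\to\Omega}\bigl(t-d^+(x,c(t))\bigr)$, where $-\infty<a<\Omega\le\infty$ and $c:[a,\Omega)\to M$ is a piecewise smooth curve with $F^+(\dot c)<1$. Put $M_B^+=B^+(M)/\mathbb R$, the quotient by additive constants, and $P_{cl}(f)=\{(t_0,x_0)\in V: t_0<f(x_0)\}$ for $f:M\to\mathbb R$. Theorem. Suppose that $g_{cl}\prec_0 g\prec_0 g_{op}$ and $\int_0^\infty\left(\frac1{\alpha(s)}-1\right)ds<\infty$. Then $P_{cl}\mapsto I^-(P_{cl})$ (the past with respect to $g$) defines an injective map $\hat j:\hat V_{cl}\to\hat V$. Hence $\hat V$ contains a point-set cone with base $M_B^+$ and apex $i^+:=V$: for every choice of a representative $b_m\in B^+(M)$ of each class $m\in M_B^+$, the assignment $$(s,m)\mapsto I^-\bigl(P_{cl}(b_m+s)\bigr),\qquad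 i^+\mapsto V,$$ defines an injective map from $(\mathbb R\times M_B^+)\cup\{i^+\}$ into $\hat V$, and its image is $\hat j(\hat V_{cl})$. -/

import Mathlib

open Set Filter Topology Manifold Bundle
open scoped ContDiff

noncomputable section

namespace IsoCausal

/-! ### Causality of a field of bilinear forms on a manifold -/

section Causality

variable {E : Type*} [NormedAddCommGroup E] [NormedSpace ℝ E]
  {H : Type*} [TopologicalSpace H] (I : ModelWithCorners ℝ E H)
  {N : Type*} [TopologicalSpace N] [ChartedSpace H N]

/-- A field of bilinear forms on the tangent spaces of `N`. -/
abbrev BilinField (N : Type*) [TopologicalSpace N] [ChartedSpace H N] : Type _ :=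
  ∀ p : N, TangentSpace I p →L[ℝ] TangentSpace I p →L[ℝ] ℝ

/-- A field of linear forms on the tangent spaces of `N`. -/
abbrev LinField (N : Type*) [TopologicalSpace N] [ChartedSpace H N] : Type _ :=
  ∀ p : N, TangentSpace I p →L[ℝ] ℝ

/-- Smoothness of a 1-form, as a section of the cotangent bundle. -/
def IsSmoothOneForm [IsManifold I ∞ N] (θ : LinField I N) : Prop :=
  ContMDiff I (I.prod 𝓘(ℝ, E →L[ℝ] ℝ)) ∞
    (fun p ↦ TotalSpace.mk' (E →L[ℝ] ℝ) (E := fun p : N ↦ TangentSpace I p →L[ℝ] ℝ) p (θ p))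

/-- Smoothness of a (0,2)-tensor field. -/
def IsSmoothBilin [IsManifold I ∞ N] (b : BilinField I N) : Prop :=
  ContMDiff I (I.prod 𝓘(ℝ, E →L[ℝ] E →L[ℝ] ℝ)) ∞
    (fun p ↦ TotalSpace.mk' (E →L[ℝ] E →L[ℝ] ℝ)
      (E := fun p : N ↦ TangentSpace I p →L[ℝ] TangentSpace I p →L[ℝ] ℝ) p (b p))

/-- `γ` is piecewise smooth on `[a, b]`, and its velocity at the parameter `s` satisfies
`K s`. The finite set `S` holds the break points: on every closed subinterval whose interior misses
`S` the curve is smooth up to the endpoints, and the velocity there (one-sided at the endpoints)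
satisfies the requirement. -/
def PiecewiseSmoothWith (K : ℝ → ∀ p : N, TangentSpace I p → Prop)
    (γ : ℝ → N) (a b : ℝ) : Prop :=
  ∃ S : Finset ℝ, ∀ u v : ℝ, a ≤ u → u < v → v ≤ b → Disjoint (S : Set ℝ) (Ioo u v) →
    ContMDiffOn 𝓘(ℝ, ℝ) I ∞ γ (Icc u v) ∧
    ∀ s ∈ Icc u v, K s (γ s) (mfderivWithin 𝓘(ℝ, ℝ) I γ (Icc u v) s (1 : ℝ))

variable {I}

/-- Future-directed timelike vectors of the Lorentzian metric `g`, the time orientation being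
the one of the timelike vector field `T`. -/
def FutureTimelike (g : BilinField I N) (T : ∀ p : N, TangentSpace I p) (p : N)
    (v : TangentSpace I p) : Prop :=
  g p v v < 0 ∧ g p v (T p) < 0

/-- Future-directed causal vectors of the Lorentzian metric `g`. -/
def FutureCausal (g : BilinField I N) (T : ∀ p : N, TangentSpace I p) (p : N)
    (v : TangentSpace I p) : Prop :=
  v ≠ 0 ∧ g p v v ≤ 0 ∧ g p v (T p) < 0

/-- `g ≺₀ g'`: the identity is a causal mapping, i.e. every future-directed causal vector of
`g` is a future-directed causal vector of `g'`. -/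
def ConesWider (T : ∀ p : N, TangentSpace I p) (g g' : BilinField I N) : Prop :=
  ∀ (p : N) (v : TangentSpace I p), FutureCausal g T p v → FutureCausal g' T p v

/-- `p ≪ q`: there is a future-directed timelike (piecewise smooth) curve from `p` to `q`. -/
def Chron (T : ∀ p : N, TangentSpace I p) (g : BilinField I N) (p q : N) : Prop :=
  ∃ (a b : ℝ) (γ : ℝ → N), a < b ∧ PiecewiseSmoothWith I (fun _ ↦ FutureTimelike g T) γ a b ∧
    γ a = p ∧ γ b = q

/-- The chronological past `I⁻(A)`. -/
def chronPast (T : ∀ p : N, TangentSpace I p) (g : BilinField I N) (A : Set N) : Set N :=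
  {p | ∃ q ∈ A, Chron T g p q}

/-- Past sets: non-empty, and equal to their own past. -/
def IsPastSet (T : ∀ p : N, TangentSpace I p) (g : BilinField I N) (P : Set N) : Prop :=
  P.Nonempty ∧ chronPast T g P = P

/-- Indecomposable past sets: past sets that are not the union of two proper past subsets. -/
def IsIP (T : ∀ p : N, TangentSpace I p) (g : BilinField I N) (P : Set N) : Prop :=
  IsPastSet T g P ∧
    ∀ P₁ P₂ : Set N, IsPastSet T g P₁ → IsPastSet T g P₂ → P = P₁ ∪ P₂ → P₁ = P ∨ P₂ = P

/-- The future completion `V̂`: the set of all indecomposable past sets. -/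
def futureCompletion (T : ∀ p : N, TangentSpace I p) (g : BilinField I N) : Set (Set N) :=
  {P | IsIP T g P}

end Causality

/-! ### The spacetimes on `ℝ × M` -/

variable {n : ℕ} {M : Type*} [TopologicalSpace M] [ChartedSpace (EuclideanSpace ℝ (Fin n)) M]

variable (n M) in
/-- Model of the product manifold `ℝ × M`. -/
abbrev prodModel : ModelWithCorners ℝ (ℝ × EuclideanSpace ℝ (Fin n))
    (ModelProd ℝ (EuclideanSpace ℝ (Fin n))) :=
  𝓘(ℝ, ℝ).prod (𝓡 n)

/-- The form `dt` on `ℝ × M`. -/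
def dt (p : ℝ × M) : TangentSpace (prodModel n) p →L[ℝ] ℝ :=
  mfderiv (prodModel n) 𝓘(ℝ, ℝ) (Prod.fst : ℝ × M → ℝ) p

/-- The differential of the projection `π_M : ℝ × M → M`. -/
def dpi (p : ℝ × M) : TangentSpace (prodModel n) p →L[ℝ] TangentSpace (𝓡 n) p.2 :=
  mfderiv (prodModel n) (𝓡 n) (Prod.snd : ℝ × M → M) p

/-- The vector field `∂_t` on `ℝ × M`: velocity of the curves `s ↦ (s, x)`. -/
def partialT (p : ℝ × M) : TangentSpace (prodModel n) p :=
  mfderiv 𝓘(ℝ, ℝ) (prodModel n) (fun s : ℝ ↦ (s, p.2)) p.1 (1 : ℝ)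

/-- The form `θ ⊗ η`. -/
def tensor {p : ℝ × M} (θ η : TangentSpace (prodModel n) p →L[ℝ] ℝ) :
    TangentSpace (prodModel n) p →L[ℝ] TangentSpace (prodModel n) p →L[ℝ] ℝ :=
  θ.smulRight η

/-- The pull-back `π_M^*θ` of a 1-form on `M`. -/
def pullForm (θ : LinField (𝓡 n) M) : LinField (prodModel n) (ℝ × M) :=
  fun p ↦ (θ p.2).comp (dpi p)

/-- The pull-back `π_M^*k` of a (0,2)-tensor on `M`: `(v, w) ↦ k(dπ_M v, dπ_M w)`. -/
def pullBilin (k : BilinField (𝓡 n) M) : BilinField (prodModel n) (ℝ × M) :=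
  fun p ↦ (ContinuousLinearMap.precomp ℝ (dpi p)).comp ((k p.2).comp (dpi p))

/-- The metric `-dt² + θ ⊗ dt + dt ⊗ θ + k` on `ℝ × M`. -/
def splitMetric (θ : LinField (prodModel n) (ℝ × M)) (k : BilinField (prodModel n) (ℝ × M)) :
    BilinField (prodModel n) (ℝ × M) :=
  fun p ↦ -tensor (dt p) (dt p) + tensor (θ p) (dt p) + tensor (dt p) (θ p) + k p

section Manifold

variable [IsManifold (𝓡 n) ∞ M]

variable (n M) in
/-- The data `ω_t`, `h_t` of a spacetime `-dt² + ω_t ⊗ dt + dt ⊗ ω_t + h_t` on `ℝ × M`: `ω_t` is a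
smooth 1-form on `ℝ × M` with `ω_t(∂_t) = 0`, and `h_t` is a Riemannian metric on each slice
`{t} × M`, depending smoothly on `t`, regarded as a symmetric tensor on `ℝ × M` that annihilates
`∂_t`. -/
structure SplitSpacetime where
  omega : LinField (prodModel n) (ℝ × M)
  omega_smooth : IsSmoothOneForm (prodModel n) omega
  omega_partialT : ∀ p, omega p (partialT p) = 0
  slice : BilinField (prodModel n) (ℝ × M)
  slice_smooth : IsSmoothBilin (prodModel n) slice
  slice_symm : ∀ p v w, slice p v w = slice p w v
  slice_partialT : ∀ p v, slice p (partialT p) v = 0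
  slice_pos : ∀ p v, dt p v = 0 → v ≠ 0 → 0 < slice p v v

/-- The metric `g` of the spacetime. -/
def SplitSpacetime.metric (D : SplitSpacetime n M) : BilinField (prodModel n) (ℝ × M) :=
  splitMetric D.omega D.slice

variable (n M) in
/-- Smooth Riemannian metrics on `M`. -/
abbrev RMetric : Type _ :=
  ContMDiffRiemannianMetric (IB := 𝓡 n) (n := ∞) (F := EuclideanSpace ℝ (Fin n))
    (E := fun x : M ↦ TangentSpace (𝓡 n) x)

/-- The metric
`g_α̃ = -dt² + α̃(t) π_M^*ω ⊗ dt + α̃(t) dt ⊗ π_M^*ω + α̃(t)² π_M^*h`. -/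
def statMetric (h : RMetric n M) (om : LinField (𝓡 n) M) (a : ℝ → ℝ) :
    BilinField (prodModel n) (ℝ × M) :=
  splitMetric (fun p ↦ a p.1 • pullForm om p)
    (fun p ↦ (a p.1) ^ 2 • pullBilin h.inner p)

/-! ### The Finsler metric and Busemann functions -/

/-- The Randers metric `F⁺(v) = √(h(v,v) + ω(v)²) + ω(v)`. -/
def finsler (h : RMetric n M) (om : LinField (𝓡 n) M) (x : M) (v : TangentSpace (𝓡 n) x) : ℝ :=
  √(h.inner x v v + (om x v) ^ 2) + om x v

/-- The length for `F⁺` of a curve on `[s₀, s₁]`. -/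
def finslerLength (h : RMetric n M) (om : LinField (𝓡 n) M) (c : ℝ → M) (s₀ s₁ : ℝ) : ℝ :=
  ∫ s in s₀..s₁, finsler h om (c s) (mfderiv 𝓘(ℝ, ℝ) (𝓡 n) c s (1 : ℝ))

/-- The generalized distance `d⁺`: infimum of the lengths of the piecewise smooth curves from `x`
to `y`. -/
def finslerDist (h : RMetric n M) (om : LinField (𝓡 n) M) (x y : M) : ℝ :=
  sInf {L : ℝ | ∃ (s₀ s₁ : ℝ) (c : ℝ → M), s₀ < s₁ ∧
    PiecewiseSmoothWith (𝓡 n) (fun _ _ _ ↦ True) c s₀ s₁ ∧ c s₀ = x ∧ c s₁ = y ∧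
    L = finslerLength h om c s₀ s₁}

/-- `f` is a finite forward Busemann function for `g_α̃`: there are `a < Ω ≤ ∞` and a piecewise smooth
curve `c : [a, Ω) → M` with `F⁺(ċ(t)) < 1 / α̃(t)`, such that
`f = lim_{t → Ω} (∫₀ᵗ ds / α̃(s) - d⁺(·, c(t)))`. -/
def IsBusemann (h : RMetric n M) (om : LinField (𝓡 n) M) (α : ℝ → ℝ) (f : M → ℝ) : Prop :=
  ∃ (a : ℝ) (Ω : EReal) (c : ℝ → M), (a : EReal) < Ω ∧
    (∀ b : ℝ, a < b → (b : EReal) < Ω →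
      PiecewiseSmoothWith (𝓡 n) (fun s x v ↦ finsler h om x v < 1 / α s) c a b) ∧
    ∀ x : M, Tendsto (fun t : ℝ ↦ (∫ s in (0 : ℝ)..t, 1 / α s) - finslerDist h om x (c t))
      (comap (fun t : ℝ ↦ (t : EReal)) (𝓝[<] Ω)) (𝓝 (f x))

/-- The set `B⁺(M)` of the finite forward Busemann functions. -/
abbrev Busemann (h : RMetric n M) (om : LinField (𝓡 n) M) (α : ℝ → ℝ) : Type _ :=
  {f : M → ℝ // IsBusemann h om α f}

/-- Busemann functions that differ by an additive constant. -/
def busemannSetoid (h : RMetric n M) (om : LinField (𝓡 n) M) (α : ℝ → ℝ) :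
    Setoid (Busemann h om α) where
  r f g := ∃ K : ℝ, ∀ x, g.1 x = f.1 x + K
  iseqv :=
    { refl := fun _ ↦ ⟨0, fun _ ↦ by simp⟩
      symm := fun ⟨K, hK⟩ ↦ ⟨-K, fun x ↦ by rw [hK x]; ring⟩
      trans := fun ⟨K, hK⟩ ⟨L, hL⟩ ↦ ⟨K + L, fun x ↦ by rw [hL x, hK x]; ring⟩ }

/-- The forward Busemann completion `M_B⁺ = B⁺(M) / ℝ`. -/
def BusemannCompletion (h : RMetric n M) (om : LinField (𝓡 n) M) (α : ℝ → ℝ) : Type _ :=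
  Quotient (busemannSetoid h om α)

/-- The class in `M_B⁺` of a Busemann function. -/
def Busemann.toCompletion {h : RMetric n M} {om : LinField (𝓡 n) M} {α : ℝ → ℝ}
    (f : Busemann h om α) : BusemannCompletion h om α :=
  Quotient.mk (busemannSetoid h om α) f

/-- The set `P_α̃(f) = {(t₀, x₀) : ∫₀^{t₀} ds / α̃(s) < f(x₀)}`. -/
def pastSetOf (α : ℝ → ℝ) (f : M → ℝ) : Set (ℝ × M) :=
  {p | (∫ s in (0 : ℝ)..p.1, 1 / α s) < f p.2}

/-- The map of the point set cone `(ℝ × M_B⁺) ∪ {i⁺}` (the apex being `none`) to the subsets of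
`V = ℝ × M` that is obtained by composing the identification of the cone with `V̂_cl`, through a choice
`σ` of one Busemann function in each class, namely `(s, m) ↦ P_cl(σ(m) + s)` and `i⁺ ↦ V`, with
`P_cl ↦ I⁻(P_cl)` for the metric `g`. -/
def coneMap {h : RMetric n M} {om : LinField (𝓡 n) M} (g : BilinField (prodModel n) (ℝ × M))
    (σ : BusemannCompletion h om (fun _ ↦ 1) → Busemann h om (fun _ ↦ 1)) :
    Option (ℝ × BusemannCompletion h om (fun _ ↦ 1)) → Set (ℝ × M)
  | none => univ
  | some (s, m) => chronPast partialT g (pastSetOf (fun _ ↦ 1) (fun x ↦ (σ m).1 x + s))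

end Manifold

end IsoCausal

end

/-!
For a metric `g_α̃` a vector `(τ, w)` is future timelike exactly when `α̃ F⁺(w) < τ`. Hence the
chronological relation of `g_cl` is read off from the generalized distance: `(t, x) ≪ (t', x')` if
and only if `d⁺(x, x') < t' - t` (`chron_one_iff`). For the forward implication one integrates
along the curve; for the converse, a curve of length less than `t' - t` is reparametrized, linearly
on the pieces of a fine subdivision, so that its speed is less than `1`. The same integration shows
that `(t, x) ≪ (t', x')` for `g` implies `d⁺(x, x') < ∫ ds / α(s)`, the integral being taken from
`t` to `t'` (`SplitSpacetime.finslerDist_lt_of_chron`).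

A past set is indecomposable if and only if it is directed for the chronological relation
(`IsPastSet.isIP`, `IsIP.directed`). As the cones of `g` are wider than those of `g_cl`, the past
for `g` of an IP for `g_cl` is directed, and therefore an IP (`IsIP.isIP_chronPast`).

Injectivity (`IsIP.subset_of_chronPast_eq`) uses the integrability of `1 / α - 1`. Suppose that
`P` and `Q` have the same past for `g`, and let `p ∈ P`. For a small `ε` the point `p + ε ∂_t` still
lies in `P`, and has there a `g_cl`-successor `r` so late that `1 / α - 1` has integral less than
`ε` between any two later times attained in `P`; the times attained in `Q` are the same. Some
`q ∈ Q` satisfies `r ≪ q` for `g`, so that `d⁺(π_M r, π_M q) < t(q) - t(r) + ε`; by the triangle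
inequality `p ≪ q` for `g_cl`, and `p ∈ Q`.

What remains is the description of the IPs of `g_cl`: apart from `V` they are the sets below the
graphs of the functions `b ∈ B⁺(M)`. The set below the graph of `b` is the past of the curve
`t ↦ (t, c t)` that defines `b`, and the past of a timelike curve is directed
(`IsBusemann.isIP`). Conversely, an IP contains a cofinal chronological sequence, because `M` is
second countable and pasts are open; joining its points gives a timelike curve `t ↦ (t, c t)` with
the IP as its past. Unless the IP is `V`, the monotone functions `t ↦ t - d⁺(x, c t)` are bounded,
and their limits define the Busemann function (`IsIP.exists_isBusemann`).
-/

namespace IsoCausal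

/-! ### Piecewise smooth curves -/

section Curves

variable {E : Type*} [NormedAddCommGroup E] [NormedSpace ℝ E]
  {H : Type*} [TopologicalSpace H] {I : ModelWithCorners ℝ E H}
  {N : Type*} [TopologicalSpace N] [ChartedSpace H N]
  {K K' : ℝ → ∀ p : N, TangentSpace I p → Prop} {γ γ' : ℝ → N} {a b c u v : ℝ}

/-- `γ` is smooth on `[u, v]` up to the endpoints, and its velocity at the parameter `s` satisfies
`K s`. -/
def SmoothArcWith (K : ℝ → ∀ p : N, TangentSpace I p → Prop) (γ : ℝ → N) (u v : ℝ) : Prop :=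
  ContMDiffOn 𝓘(ℝ, ℝ) I ∞ γ (Icc u v) ∧
    ∀ s ∈ Icc u v, K s (γ s) (mfderivWithin 𝓘(ℝ, ℝ) I γ (Icc u v) s (1 : ℝ))

theorem SmoothArcWith.congr (h : SmoothArcWith K γ u v) (he : EqOn γ' γ (Icc u v)) :
    SmoothArcWith K γ' u v := by
  refine ⟨h.1.congr he, fun s hs ↦ ?_⟩
  have key : ∀ (p q : N) (w w' : E), p = q → w = w' → K s p w → K s q w' := by
    rintro p _ w _ rfl rfl hw
    exact hw
  refine key _ _ _ _ (he hs).symm ?_ (h.2 s hs)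
  exact DFunLike.congr_fun (mfderivWithin_congr_of_mem he hs).symm (1 : ℝ)

theorem uniqueMDiffWithinAt_Icc_of_lt (huv : u < v) {s : ℝ} (hs : s ∈ Icc u v) :
    UniqueMDiffWithinAt 𝓘(ℝ, ℝ) (Icc u v) s :=
  (uniqueDiffOn_Icc huv s hs).uniqueMDiffWithinAt

theorem SmoothArcWith.mono {u' v' : ℝ} (h : SmoothArcWith K γ u v) (hu : u ≤ u') (huv : u' < v')
    (hv : v' ≤ v) : SmoothArcWith K γ u' v' := by
  have hsub : Icc u' v' ⊆ Icc u v := Icc_subset_Icc hu hv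
  refine ⟨h.1.mono hsub, fun s hs ↦ ?_⟩
  rw [mfderivWithin_subset hsub (uniqueMDiffWithinAt_Icc_of_lt huv hs)
    ((h.1 s (hsub hs)).mdifferentiableWithinAt (by simp))]
  exact h.2 s (hsub hs)

theorem SmoothArcWith.imp (h : SmoothArcWith K γ u v)
    (hK : ∀ s ∈ Icc u v, ∀ p w, K s p w → K' s p w) : SmoothArcWith K' γ u v :=
  ⟨h.1, fun s hs ↦ hK s hs _ _ (h.2 s hs)⟩

theorem SmoothArcWith.piecewise (h : SmoothArcWith K γ a b) : PiecewiseSmoothWith I K γ a b :=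
  ⟨∅, fun _ _ hu huv hv _ ↦ h.mono hu huv hv⟩

theorem PiecewiseSmoothWith.of_arcs {E' H' N' : Type*} [NormedAddCommGroup E'] [NormedSpace ℝ E']
    [TopologicalSpace H'] {I' : ModelWithCorners ℝ E' H'} [TopologicalSpace N']
    [ChartedSpace H' N'] {K' : ℝ → ∀ p : N', TangentSpace I' p → Prop} {γ' : ℝ → N'}
    (h : PiecewiseSmoothWith I K γ a b)
    (hK : ∀ u v, a ≤ u → u < v → v ≤ b → SmoothArcWith K γ u v → SmoothArcWith K' γ' u v) :
    PiecewiseSmoothWith I' K' γ' a b := by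
  obtain ⟨S, hS⟩ := h
  exact ⟨S, fun u v hu huv hv hd ↦ hK u v hu huv hv (hS u v hu huv hv hd)⟩

theorem PiecewiseSmoothWith.congr (h : PiecewiseSmoothWith I K γ a b)
    (he : EqOn γ' γ (Icc a b)) : PiecewiseSmoothWith I K γ' a b :=
  h.of_arcs fun _ _ hu _ hv hs ↦ hs.congr (he.mono (Icc_subset_Icc hu hv))

theorem PiecewiseSmoothWith.imp (h : PiecewiseSmoothWith I K γ a b)
    (hK : ∀ s ∈ Icc a b, ∀ p w, K s p w → K' s p w) : PiecewiseSmoothWith I K' γ a b :=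
  h.of_arcs fun _ _ hu _ hv hs ↦ hs.imp fun s hs ↦ hK s (Icc_subset_Icc hu hv hs)

theorem PiecewiseSmoothWith.mono (h : PiecewiseSmoothWith I K γ a b) (hu : a ≤ u) (hv : v ≤ b) :
    PiecewiseSmoothWith I K γ u v := by
  obtain ⟨S, hS⟩ := h
  exact ⟨S, fun u' v' hu' huv hv' hd ↦ hS u' v' (hu.trans hu') huv (hv'.trans hv) hd⟩

theorem PiecewiseSmoothWith.glue (h₁ : PiecewiseSmoothWith I K γ a b)
    (h₂ : PiecewiseSmoothWith I K γ b c) : PiecewiseSmoothWith I K γ a c := by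
  classical
  obtain ⟨S, hS⟩ := h₁
  obtain ⟨S', hS'⟩ := h₂
  refine ⟨insert b (S ∪ S'), fun u v hu huv hv hd ↦ ?_⟩
  simp only [Finset.coe_insert, Finset.coe_union, disjoint_insert_left, disjoint_union_left,
    mem_Ioo, not_and, not_lt] at hd
  obtain ⟨hb, hd, hd'⟩ := hd
  rcases lt_or_ge u b with hub | hub
  · exact hS u v hu huv (hb hub) hd
  · exact hS' u v hub huv hv hd'

/-- Concatenation of two piecewise smooth curves. -/
theorem PiecewiseSmoothWith.concat (h₁ : PiecewiseSmoothWith I K γ a b)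
    (h₂ : PiecewiseSmoothWith I K γ' b c) (hb : γ b = γ' b) :
    PiecewiseSmoothWith I K (fun s ↦ if s ≤ b then γ s else γ' s) a c := by
  refine (h₁.congr fun s hs ↦ ?_).glue (h₂.congr fun s hs ↦ ?_)
  · exact if_pos hs.2
  · rcases hs.1.eq_or_lt with rfl | hlt
    · simpa using hb
    · exact if_neg hlt.not_ge

theorem SmoothArcWith.comp_affine {m k : ℝ} (hm : 0 < m) (huv : u < v)
    (h : SmoothArcWith K γ (m * u + k) (m * v + k))
    (hK : ∀ s ∈ Icc u v, ∀ p (w : TangentSpace I p), K (m * s + k) p w → K' s p (m • w)) :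
    SmoothArcWith K' (fun s ↦ γ (m * s + k)) u v := by
  have hmaps : MapsTo (fun s : ℝ ↦ m * s + k) (Icc u v) (Icc (m * u + k) (m * v + k)) :=
    fun s hs ↦ ⟨by nlinarith [hs.1], by nlinarith [hs.2]⟩
  have hθ : ContMDiff 𝓘(ℝ, ℝ) 𝓘(ℝ, ℝ) ∞ (fun s : ℝ ↦ m * s + k) := by
    apply ContDiff.contMDiff
    fun_prop
  refine ⟨h.1.comp hθ.contMDiffOn hmaps, fun s hs ↦ ?_⟩
  have hder : HasDerivAt (fun s : ℝ ↦ m * s + k) m s := by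
    simpa using ((hasDerivAt_id s).const_mul m).add_const k
  have e : mfderivWithin 𝓘(ℝ, ℝ) I (fun s ↦ γ (m * s + k)) (Icc u v) s (1 : ℝ) =
      m • mfderivWithin 𝓘(ℝ, ℝ) I γ (Icc (m * u + k) (m * v + k)) (m * s + k) (1 : ℝ) := by
    have := mfderivWithin_comp (I := 𝓘(ℝ, ℝ)) (I' := 𝓘(ℝ, ℝ)) (I'' := I) (x := s)
      (f := fun s : ℝ ↦ m * s + k) (g := γ) (s := Icc u v) (u := Icc (m * u + k) (m * v + k))
      ((h.1 _ (hmaps hs)).mdifferentiableWithinAt (by simp))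
      (hθ.mdifferentiable (by simp) s).mdifferentiableWithinAt hmaps
      (uniqueMDiffWithinAt_Icc_of_lt huv hs)
    have e2 := DFunLike.congr_fun this (1 : ℝ)
    refine e2.trans ?_
    have e3 : mfderivWithin 𝓘(ℝ, ℝ) 𝓘(ℝ, ℝ) (fun s : ℝ ↦ m * s + k) (Icc u v) s (1 : ℝ) = m := by
      have : fderivWithin ℝ (fun s : ℝ ↦ m * s + k) (Icc u v) s (1 : ℝ) = m := by
        rw [(hder.hasFDerivAt.hasFDerivWithinAt).fderivWithin (uniqueDiffOn_Icc huv s hs)]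
        simp
      exact (DFunLike.congr_fun mfderivWithin_eq_fderivWithin (1 : ℝ)).trans this
    have e4 : ∀ L : ℝ →L[ℝ] E, L m = m • L 1 := fun L ↦ by
      rw [← map_smul, smul_eq_mul, mul_one]
    exact (congrArg (mfderivWithin 𝓘(ℝ, ℝ) I γ (Icc (m * u + k) (m * v + k)) (m * s + k)) e3).trans
      (e4 _)
  rw [e]
  exact hK s hs _ _ (h.2 _ (hmaps hs))

theorem PiecewiseSmoothWith.comp_affine {m k : ℝ} (hm : 0 < m)
    (h : PiecewiseSmoothWith I K γ (m * a + k) (m * b + k))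
    (hK : ∀ s ∈ Icc a b, ∀ p (w : TangentSpace I p), K (m * s + k) p w → K' s p (m • w)) :
    PiecewiseSmoothWith I K' (fun s ↦ γ (m * s + k)) a b := by
  classical
  obtain ⟨S, hS⟩ := h
  refine ⟨S.image fun s ↦ (s - k) / m, fun u v hu huv hv hd ↦ ?_⟩
  refine SmoothArcWith.comp_affine hm huv (hS _ _ (by nlinarith) (by nlinarith) (by nlinarith) ?_)
    fun s hs ↦ hK s ⟨hu.trans hs.1, hs.2.trans hv⟩
  rw [Set.disjoint_left] at hd ⊢
  intro s hs hs'
  refine hd (a := (s - k) / m) (by simpa using ⟨s, hs, rfl⟩) ⟨?_, ?_⟩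
  · rw [lt_div_iff₀ hm]; nlinarith [hs'.1]
  · rw [div_lt_iff₀ hm]; nlinarith [hs'.2]

/-- A relation between parameters that is transitive, and holds between the ends of each smooth
arc of a piecewise smooth curve, holds between the ends of the curve. -/
theorem PiecewiseSmoothWith.induction_arcs (h : PiecewiseSmoothWith I K γ a b) (hab : a < b)
    {Q : ℝ → ℝ → Prop}
    (harc : ∀ u v, a ≤ u → u < v → v ≤ b → SmoothArcWith K γ u v → Q u v)
    (htrans : ∀ u v w, u < v → v < w → Q u v → Q v w → Q u w) : Q a b := by
  classical
  obtain ⟨S, hS⟩ := h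
  suffices H : ∀ (k : ℕ) (u v : ℝ), a ≤ u → u < v → v ≤ b →
      (S.filter fun s ↦ s ∈ Ioo u v).card = k → Q u v from H _ a b le_rfl hab le_rfl rfl
  intro k
  induction k using Nat.strong_induction_on with
  | _ k ih =>
    intro u v hu huv hv hk
    by_cases hd : Disjoint (S : Set ℝ) (Ioo u v)
    · exact harc u v hu huv hv (hS u v hu huv hv hd)
    · obtain ⟨w, hwS, hw⟩ := Set.not_disjoint_iff.1 hd
      refine htrans u w v hw.1 hw.2 (ih _ ?_ u w hu hw.1 (hw.2.le.trans hv) rfl)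
        (ih _ ?_ w v (hu.trans hw.1.le) hw.2 hv rfl)
      · rw [← hk]
        refine Finset.card_lt_card (Finset.ssubset_iff_of_subset ?_ |>.2 ⟨w, ?_, ?_⟩)
        · intro s hs
          simp only [Finset.mem_filter, mem_Ioo] at hs ⊢
          exact ⟨hs.1, hs.2.1, hs.2.2.trans hw.2⟩
        · simpa using ⟨hwS, hw⟩
        · simp
      · rw [← hk]
        refine Finset.card_lt_card (Finset.ssubset_iff_of_subset ?_ |>.2 ⟨w, ?_, ?_⟩)
        · intro s hs
          simp only [Finset.mem_filter, mem_Ioo] at hs ⊢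
          exact ⟨hs.1, hw.1.trans hs.2.1, hs.2.2⟩
        · simpa using ⟨hwS, hw⟩
        · simp

/-- Concatenation of a sequence of piecewise smooth curves. -/
theorem exists_piecewiseSmoothWith_of_seq {t : ℕ → ℝ} (ht : StrictMono t) {x : ℕ → N}
    {γ : ℕ → ℝ → N}
    (hγ : ∀ k, PiecewiseSmoothWith I K (γ k) (t k) (t (k + 1)))
    (hl : ∀ k, γ k (t k) = x k) (hr : ∀ k, γ k (t (k + 1)) = x (k + 1)) :
    ∃ c : ℝ → N, (∀ k, PiecewiseSmoothWith I K c (t 0) (t k)) ∧ ∀ k, c (t k) = x k := by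
  classical
  let c : ℝ → N := fun s ↦ if hs : ∃ k, s ≤ t (k + 1) then γ (Nat.find hs) s else x 0
  have hc : ∀ k, EqOn c (γ k) (Icc (t k) (t (k + 1))) := by
    intro k s hs
    have hex : ∃ k, s ≤ t (k + 1) := ⟨k, hs.2⟩
    have hcs : c s = γ (Nat.find hex) s := dif_pos hex
    rw [hcs]
    rcases (Nat.find_min' hex hs.2).eq_or_lt with heq | hlt
    · rw [heq]
    · -- only the left endpoint also belongs to an earlier interval
      have h1 : s ≤ t (Nat.find hex + 1) := Nat.find_spec hex
      have h2 : t (Nat.find hex + 1) ≤ t k := ht.monotone hlt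
      have hsk : s = t k := le_antisymm (h1.trans h2) hs.1
      have hk : Nat.find hex + 1 = k := ht.injective (le_antisymm h2 (hsk ▸ h1))
      have e1 := hr (Nat.find hex)
      rw [hk, ← hsk] at e1
      rw [e1, hsk, hl]
  refine ⟨c, fun k ↦ ?_, fun k ↦ ?_⟩
  · induction k with
    | zero => exact ⟨∅, fun u v hu huv hv _ ↦ by linarith⟩
    | succ k ih => exact ih.glue ((hγ k).congr (hc k))
  · rw [hc k ⟨le_rfl, (ht k.lt_succ_self).le⟩, hl]

end Curves

/-! ### Past sets and indecomposability -/

section Order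

variable {E : Type*} [NormedAddCommGroup E] [NormedSpace ℝ E]
  {H : Type*} [TopologicalSpace H] {I : ModelWithCorners ℝ E H}
  {N : Type*} [TopologicalSpace N] [ChartedSpace H N]
  {T : ∀ p : N, TangentSpace I p} {g g' : BilinField I N} {p q r : N} {A B P : Set N}

theorem Chron.trans (h₁ : Chron T g p q) (h₂ : Chron T g q r) : Chron T g p r := by
  obtain ⟨a, b, γ, hab, hγ, rfl, rfl⟩ := h₁
  obtain ⟨a', b', γ', hab', hγ', hq, rfl⟩ := h₂
  have h2 : PiecewiseSmoothWith I (fun _ ↦ FutureTimelike g T)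
      (fun s ↦ γ' (1 * s + (a' - b))) b (b + (b' - a')) := by
    refine PiecewiseSmoothWith.comp_affine (K := fun _ ↦ FutureTimelike g T) one_pos ?_ ?_
    · convert hγ' using 1 <;> ring
    · intro s _ p w hw
      rwa [one_smul]
  refine ⟨a, b + (b' - a'), _, by linarith, hγ.concat h2 ?_, ?_, ?_⟩
  · rw [← hq]; congr 1; ring
  · simp [hab.le]
  · rw [if_neg (by linarith)]; congr 1; ring

theorem Chron.exists_between (h : Chron T g p q) : ∃ r, Chron T g p r ∧ Chron T g r q := by
  obtain ⟨a, b, γ, hab, hγ, rfl, rfl⟩ := h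
  exact ⟨γ ((a + b) / 2),
    ⟨a, (a + b) / 2, γ, by linarith, hγ.mono le_rfl (by linarith), rfl, rfl⟩,
    ⟨(a + b) / 2, b, γ, by linarith, hγ.mono (by linarith) le_rfl, rfl, rfl⟩⟩

theorem Chron.of_timelike_imp (hg : ∀ p v, FutureTimelike g T p v → FutureTimelike g' T p v)
    (h : Chron T g p q) : Chron T g' p q := by
  obtain ⟨a, b, γ, hab, hγ, hp, hq⟩ := h
  exact ⟨a, b, γ, hab, hγ.imp fun _ _ ↦ hg, hp, hq⟩

theorem chronPast_chronPast (A : Set N) : chronPast T g (chronPast T g A) = chronPast T g A := by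
  apply Subset.antisymm
  · rintro p ⟨q, ⟨r, hr, hqr⟩, hpq⟩
    exact ⟨r, hr, hpq.trans hqr⟩
  · rintro p ⟨q, hq, hpq⟩
    obtain ⟨r, hpr, hrq⟩ := hpq.exists_between
    exact ⟨r, ⟨q, hq, hrq⟩, hpr⟩

theorem isPastSet_chronPast (hpast : ∀ p, ∃ q, Chron T g q p) (hA : A.Nonempty) :
    IsPastSet T g (chronPast T g A) := by
  obtain ⟨p, hp⟩ := hA
  obtain ⟨q, hq⟩ := hpast p
  exact ⟨⟨q, p, hp, hq⟩, chronPast_chronPast A⟩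

theorem IsPastSet.mem_of_chron (h : IsPastSet T g P) (hpq : Chron T g p q) (hq : q ∈ P) :
    p ∈ P := by
  rw [← h.2]
  exact ⟨q, hq, hpq⟩

theorem IsPastSet.exists_chron (h : IsPastSet T g P) (hp : p ∈ P) : ∃ q ∈ P, Chron T g p q := by
  rw [← h.2] at hp
  exact hp

/-- A past set in which any two points have a common chronological successor is
indecomposable. -/
theorem IsPastSet.isIP (h : IsPastSet T g P)
    (hdir : ∀ p ∈ P, ∀ q ∈ P, ∃ r ∈ P, Chron T g p r ∧ Chron T g q r) : IsIP T g P := by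
  refine ⟨h, fun P₁ P₂ h₁ h₂ hP ↦ ?_⟩
  by_contra! hne
  have hs₁ : P₁ ⊆ P := hP ▸ subset_union_left
  have hs₂ : P₂ ⊆ P := hP ▸ subset_union_right
  obtain ⟨p, hp, hp₁⟩ := not_subset.1 fun hs ↦ hne.1 (hs₁.antisymm hs)
  obtain ⟨q, hq, hq₂⟩ := not_subset.1 fun hs ↦ hne.2 (hs₂.antisymm hs)
  obtain ⟨r, hr, hpr, hqr⟩ := hdir p hp q hq
  rcases hP ▸ hr with hr | hr
  · exact hp₁ (h₁.mem_of_chron hpr hr)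
  · exact hq₂ (h₂.mem_of_chron hqr hr)

/-- Conversely, an indecomposable past set is directed: for `p ∈ P` it is the union of the
pasts of `P ∩ I⁺(p)` and of `P \ I⁺(p)`, and `p` does not lie in the second one. -/
theorem IsIP.directed (hirr : ∀ p, ¬ Chron T g p p) (hpast : ∀ p, ∃ q, Chron T g q p)
    (h : IsIP T g P) (hp : p ∈ P) (hq : q ∈ P) : ∃ r ∈ P, Chron T g p r ∧ Chron T g q r := by
  obtain ⟨p', hp', hpp'⟩ := h.1.exists_chron hp
  have h₁ : IsPastSet T g (chronPast T g (P ∩ {r | Chron T g p r})) :=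
    isPastSet_chronPast hpast ⟨p', hp', hpp'⟩
  have h₂ : IsPastSet T g (chronPast T g (P \ {r | Chron T g p r})) :=
    isPastSet_chronPast hpast ⟨p, hp, hirr p⟩
  have hP : P = chronPast T g (P ∩ {r | Chron T g p r}) ∪
      chronPast T g (P \ {r | Chron T g p r}) := by
    apply Subset.antisymm
    · intro x hx
      obtain ⟨y, hy, hxy⟩ := h.1.exists_chron hx
      by_cases hpy : Chron T g p y
      · exact Or.inl ⟨y, ⟨hy, hpy⟩, hxy⟩
      · exact Or.inr ⟨y, ⟨hy, hpy⟩, hxy⟩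
    · rintro x (⟨y, hy, hxy⟩ | ⟨y, hy, hxy⟩) <;> exact h.1.mem_of_chron hxy hy.1
  rcases h.2 _ _ h₁ h₂ hP with h' | h'
  · rw [← h'] at hq
    obtain ⟨r, ⟨hr, hpr⟩, hqr⟩ := hq
    exact ⟨r, hr, hpr, hqr⟩
  · rw [← h'] at hp
    obtain ⟨r, ⟨_, hpr⟩, hpr'⟩ := hp
    exact absurd hpr' hpr

end Order

/-! ### Cones of the metrics on `ℝ × M` -/

section Cones

variable {n : ℕ} {M : Type*} [TopologicalSpace M] [ChartedSpace (EuclideanSpace ℝ (Fin n)) M]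

theorem dt_apply (p : ℝ × M) (v : TangentSpace (prodModel n) p) :
    dt p v = (show ℝ × EuclideanSpace ℝ (Fin n) from v).1 := by
  unfold dt
  rw [mfderiv_fst]
  rfl

theorem dpi_apply (p : ℝ × M) (v : TangentSpace (prodModel n) p) :
    dpi p v = (show ℝ × EuclideanSpace ℝ (Fin n) from v).2 := by
  unfold dpi
  rw [mfderiv_snd]
  rfl

theorem partialT_eq (p : ℝ × M) :
    partialT p = (show TangentSpace (prodModel n) p from
      ((1, 0) : ℝ × EuclideanSpace ℝ (Fin n))) := by
  have := mfderiv_prodMk (I := 𝓘(ℝ, ℝ)) (I' := 𝓘(ℝ, ℝ)) (I'' := 𝓡 n) (x := p.1)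
    (f := fun s : ℝ ↦ s) (g := fun _ : ℝ ↦ p.2) mdifferentiableAt_id mdifferentiableAt_const
  have h2 := DFunLike.congr_fun this (1 : ℝ)
  refine h2.trans ?_
  have e1 : mfderiv 𝓘(ℝ, ℝ) 𝓘(ℝ, ℝ) (fun s : ℝ ↦ s) p.1 (1 : ℝ) = (1 : ℝ) :=
    DFunLike.congr_fun (mfderiv_id (I := 𝓘(ℝ, ℝ)) (x := p.1)) (1 : ℝ)
  have e2 : mfderiv 𝓘(ℝ, ℝ) (𝓡 n) (fun _ : ℝ ↦ p.2) p.1 (1 : ℝ) =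
      (0 : EuclideanSpace ℝ (Fin n)) :=
    DFunLike.congr_fun (mfderiv_const (I := 𝓘(ℝ, ℝ)) (I' := 𝓡 n) (x := p.1) (c := p.2)) (1 : ℝ)
  exact Prod.ext e1 e2

theorem dt_partialT (p : ℝ × M) : dt (n := n) p (partialT p) = 1 := by
  rw [dt_apply, partialT_eq]

theorem dpi_partialT (p : ℝ × M) : dpi (n := n) p (partialT p) = 0 := by
  rw [dpi_apply, partialT_eq]
  rfl

theorem splitMetric_apply (θ : LinField (prodModel n) (ℝ × M))
    (k : BilinField (prodModel n) (ℝ × M)) (p : ℝ × M) (v w : TangentSpace (prodModel n) p) :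
    splitMetric θ k p v w =
      -(dt p v * dt p w) + θ p v * dt p w + dt p v * θ p w + k p v w := rfl

/-- If the causal cones of `g` are contained in those of `g'`, then so are the timelike cones:
for `v` timelike and small `ε > 0` the vector `v - ε ∂_t` is causal for `g`, hence for `g'`, and
adding `ε ∂_t` to it gives a vector that is timelike for `g'`. -/
theorem ConesWider.futureTimelike {T : ∀ p : ℝ × M, TangentSpace (prodModel n) p}
    {g g' : BilinField (prodModel n) (ℝ × M)} (h : ConesWider T g g')
    (hg : ∀ p v w, g p v w = g p w v) (hg' : ∀ p v w, g' p v w = g' p w v)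
    (hT : ∀ p, g p (T p) (T p) = -1) (hT' : ∀ p, g' p (T p) (T p) = -1)
    (p : ℝ × M) (v : TangentSpace (prodModel n) p) (hv : FutureTimelike g T p v) :
    FutureTimelike g' T p v := by
  obtain ⟨h1, h2⟩ := hv
  obtain ⟨ε, hε, hε1, hε2⟩ : ∃ ε : ℝ, 0 < ε ∧ ε < -g p v (T p) ∧
      ε * (-2 * g p v (T p)) ≤ -g p v v := by
    refine ⟨min (-g p v (T p) / 2) (-g p v v / (-2 * g p v (T p))), ?_, ?_, ?_⟩
    · refine lt_min (by linarith) (div_pos (by linarith) (by linarith))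
    · exact (min_le_left _ _).trans_lt (by linarith)
    · rw [← le_div_iff₀ (by linarith)]
      exact min_le_right _ _
  have exp : ∀ (b : TangentSpace (prodModel n) p →L[ℝ] TangentSpace (prodModel n) p →L[ℝ] ℝ)
      (x y : TangentSpace (prodModel n) p) (e : ℝ), b (x + e • y) (x + e • y) =
        b x x + e * b x y + e * b y x + e ^ 2 * b y y := by
    intro b x y e
    simp only [map_add, map_smul, add_apply, smul_apply,
      smul_eq_mul]
    ring
  have exp2 : ∀ (b : TangentSpace (prodModel n) p →L[ℝ] TangentSpace (prodModel n) p →L[ℝ] ℝ)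
      (x y : TangentSpace (prodModel n) p) (e : ℝ), b (x + e • y) y = b x y + e * b y y := by
    intro b x y e
    simp only [map_add, map_smul, add_apply, smul_apply,
      smul_eq_mul]
  have hlt : g p (v + (-ε) • T p) (T p) < 0 := by
    rw [exp2, hT]; linarith
  have hc := h p (v + (-ε) • T p) ⟨fun h0 ↦ by rw [h0] at hlt; simp at hlt, by
    rw [exp, hg p (T p) v, hT]; nlinarith, hlt⟩
  obtain ⟨-, c1, c2⟩ := hc
  have hv : v = (v + (-ε) • T p) + ε • T p := by
    rw [add_assoc, ← add_smul]; simp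
  refine ⟨?_, ?_⟩
  · rw [hv, exp, hg' p (T p), hT']
    nlinarith
  · rw [hv, exp2, hT']
    linarith

variable [IsManifold (𝓡 n) ∞ M]

theorem SplitSpacetime.metric_symm (D : SplitSpacetime n M) (p : ℝ × M)
    (v w : TangentSpace (prodModel n) p) : D.metric p v w = D.metric p w v := by
  unfold SplitSpacetime.metric
  rw [splitMetric_apply, splitMetric_apply, D.slice_symm]
  ring

theorem SplitSpacetime.metric_partialT (D : SplitSpacetime n M) (p : ℝ × M) :
    D.metric p (partialT p) (partialT p) = -1 := by
  unfold SplitSpacetime.metric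
  rw [splitMetric_apply, D.slice_partialT, D.omega_partialT, dt_partialT]
  ring

theorem statMetric_apply (h : RMetric n M) (om : LinField (𝓡 n) M) (a : ℝ → ℝ) (p : ℝ × M)
    (v w : TangentSpace (prodModel n) p) :
    statMetric h om a p v w = -(dt p v * dt p w) + a p.1 * om p.2 (dpi p v) * dt p w +
      dt p v * (a p.1 * om p.2 (dpi p w)) + a p.1 ^ 2 * h.inner p.2 (dpi p v) (dpi p w) := rfl

theorem statMetric_symm (h : RMetric n M) (om : LinField (𝓡 n) M) (a : ℝ → ℝ) (p : ℝ × M)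
    (v w : TangentSpace (prodModel n) p) :
    statMetric h om a p v w = statMetric h om a p w v := by
  rw [statMetric_apply, statMetric_apply, h.symm]
  ring

theorem statMetric_partialT (h : RMetric n M) (om : LinField (𝓡 n) M) (a : ℝ → ℝ) (p : ℝ × M) :
    statMetric h om a p (partialT p) (partialT p) = -1 := by
  rw [statMetric_apply, dt_partialT, dpi_partialT]
  simp

theorem inner_self_nonneg (h : RMetric n M) (x : M) (v : TangentSpace (𝓡 n) x) :
    0 ≤ h.inner x v v := by
  by_cases hv : v = 0
  · simp [hv]
  · exact (h.pos x v hv).le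

theorem finsler_nonneg (h : RMetric n M) (om : LinField (𝓡 n) M) (x : M)
    (v : TangentSpace (𝓡 n) x) : 0 ≤ finsler h om x v := by
  have : |om x v| ≤ √(h.inner x v v + (om x v) ^ 2) :=
    Real.abs_le_sqrt (by linarith [inner_self_nonneg h x v])
  unfold finsler
  linarith [neg_abs_le (om x v)]

theorem finsler_zero (h : RMetric n M) (om : LinField (𝓡 n) M) (x : M) :
    finsler h om x 0 = 0 := by
  simp [finsler]

theorem finsler_smul (h : RMetric n M) (om : LinField (𝓡 n) M) (x : M)
    (v : TangentSpace (𝓡 n) x) {m : ℝ} (hm : 0 ≤ m) :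
    finsler h om x (m • v) = m * finsler h om x v := by
  have : h.inner x (m • v) (m • v) + (om x (m • v)) ^ 2 =
      m ^ 2 * (h.inner x v v + (om x v) ^ 2) := by
    simp only [map_smul, smul_apply, smul_eq_mul]
    ring
  unfold finsler
  rw [this, Real.sqrt_mul (sq_nonneg m), Real.sqrt_sq hm]
  simp only [map_smul, smul_eq_mul]
  ring

/-- The future timelike cones of `g_α̃` in terms of the Randers metric. -/
theorem futureTimelike_statMetric_iff (h : RMetric n M) (om : LinField (𝓡 n) M) {a : ℝ → ℝ}
    (ha : ∀ t, 0 < a t) (p : ℝ × M) (v : TangentSpace (prodModel n) p) :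
    FutureTimelike (statMetric h om a) partialT p v ↔
      a p.1 * finsler h om p.2 (dpi p v) < dt p v := by
  have hin := inner_self_nonneg h p.2 (dpi p v)
  have hap := ha p.1
  have e2 : statMetric h om a p v (partialT p) = -(dt p v - a p.1 * om p.2 (dpi p v)) := by
    rw [statMetric_apply, dt_partialT, dpi_partialT]
    simp
    ring
  have e1 : statMetric h om a p v v =
      a p.1 ^ 2 * (h.inner p.2 (dpi p v) (dpi p v) + om p.2 (dpi p v) ^ 2) -
        (dt p v - a p.1 * om p.2 (dpi p v)) ^ 2 := by
    rw [statMetric_apply]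
    ring
  have e3 : a p.1 * finsler h om p.2 (dpi p v) < dt p v ↔
      √(a p.1 ^ 2 * (h.inner p.2 (dpi p v) (dpi p v) + om p.2 (dpi p v) ^ 2)) <
        dt p v - a p.1 * om p.2 (dpi p v) := by
    rw [Real.sqrt_mul (sq_nonneg _), Real.sqrt_sq hap.le, finsler, mul_add, lt_sub_iff_add_lt]
  rw [e3, FutureTimelike, e1, e2]
  constructor
  · rintro ⟨h1, h2⟩
    exact (Real.sqrt_lt' (by linarith)).2 (by linarith)
  · intro h1
    have h2 := (Real.sqrt_nonneg _).trans_lt h1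
    exact ⟨by linarith [(Real.sqrt_lt' h2).1 h1], by linarith⟩


/-- The Randers metric is a continuous function on the tangent bundle. -/
theorem continuous_finsler (h : RMetric n M) {om : LinField (𝓡 n) M}
    (hom : IsSmoothOneForm (𝓡 n) om) :
    Continuous fun v : TangentBundle (𝓡 n) M ↦ finsler h om v.1 v.2 := by
  have hproj : Continuous fun v : TangentBundle (𝓡 n) M ↦ v.1 :=
    FiberBundle.continuous_proj (EuclideanSpace ℝ (Fin n)) (TangentSpace (𝓡 n) : M → Type _)
  have hid : Continuous fun v : TangentBundle (𝓡 n) M ↦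
      TotalSpace.mk' (EuclideanSpace ℝ (Fin n)) (E := fun x : M ↦ TangentSpace (𝓡 n) x) v.1 v.2 :=
    continuous_id
  have h1 : Continuous fun v : TangentBundle (𝓡 n) M ↦
      TotalSpace.mk' ℝ (E := Bundle.Trivial M ℝ) v.1 (h.inner v.1 v.2 v.2) :=
    (h.contMDiff.continuous.comp hproj).clm_bundle_apply₂ (F₁ := EuclideanSpace ℝ (Fin n))
      (F₂ := EuclideanSpace ℝ (Fin n)) hid hid
  have h2 : Continuous fun v : TangentBundle (𝓡 n) M ↦
      TotalSpace.mk' ℝ (E := Bundle.Trivial M ℝ) v.1 (om v.1 v.2) :=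
    ((ContMDiff.continuous hom).comp hproj).clm_bundle_apply (F₁ := EuclideanSpace ℝ (Fin n))
      (F₂ := ℝ) hid
  have h1' : Continuous fun v : TangentBundle (𝓡 n) M ↦ h.inner v.1 v.2 v.2 := by
    rw [continuous_iff_continuousAt] at h1 ⊢
    intro x
    have := h1 x
    rw [FiberBundle.continuousAt_totalSpace] at this
    exact this.2
  have h2' : Continuous fun v : TangentBundle (𝓡 n) M ↦ om v.1 v.2 := by
    rw [continuous_iff_continuousAt] at h2 ⊢
    intro x
    have := h2 x
    rw [FiberBundle.continuousAt_totalSpace] at this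
    exact this.2
  unfold finsler
  exact (Real.continuous_sqrt.comp (h1'.add (h2'.pow 2))).add h2'

end Cones

/-! ### Curves of Randers length less than the elapsed time -/

section Graph

variable {n : ℕ} {M : Type*} [TopologicalSpace M] [ChartedSpace (EuclideanSpace ℝ (Fin n)) M]
  [IsManifold (𝓡 n) ∞ M] {h : RMetric n M} {om : LinField (𝓡 n) M} {p q r : ℝ × M}

/-- The points `p` and `q` of `ℝ × M` lie on the graph `{(t, c t)}` of a piecewise smooth curve
`c` in `M` whose Randers speed is less than `1`, with `p` before `q`. -/
def GraphCurve (h : RMetric n M) (om : LinField (𝓡 n) M) (p q : ℝ × M) : Prop :=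
  p.1 < q.1 ∧ ∃ c : ℝ → M,
    PiecewiseSmoothWith (𝓡 n) (fun _ x v ↦ finsler h om x v < 1) c p.1 q.1 ∧
      c p.1 = p.2 ∧ c q.1 = q.2

theorem GraphCurve.trans (h₁ : GraphCurve h om p q) (h₂ : GraphCurve h om q r) :
    GraphCurve h om p r := by
  obtain ⟨hpq, c, hc, hp, hq⟩ := h₁
  obtain ⟨hqr, c', hc', hq', hr⟩ := h₂
  refine ⟨hpq.trans hqr, _, hc.concat hc' (hq.trans hq'.symm), ?_, ?_⟩
  · simp [hpq.le, hp]
  · simp [hqr, hr]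

theorem GraphCurve.translate (k : ℝ) (h₁ : GraphCurve h om p q) :
    GraphCurve h om (p.1 + k, p.2) (q.1 + k, q.2) := by
  obtain ⟨hpq, c, hc, hp, hq⟩ := h₁
  refine ⟨by simpa using hpq, fun s ↦ c (1 * s + -k),
    PiecewiseSmoothWith.comp_affine (K := fun _ x v ↦ finsler h om x v < 1) one_pos ?_ ?_, ?_, ?_⟩
  · simpa using hc
  · intro s _ x v hv
    rwa [one_smul]
  · simpa using hp
  · simpa using hq

omit [IsManifold (𝓡 n) ∞ M] in
theorem mfderivWithin_const_apply {u v s : ℝ} (x : M) :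
    mfderivWithin 𝓘(ℝ, ℝ) (𝓡 n) (fun _ : ℝ ↦ x) (Icc u v) s (1 : ℝ) =
      (0 : EuclideanSpace ℝ (Fin n)) :=
  DFunLike.congr_fun
    (mfderivWithin_const (I := 𝓘(ℝ, ℝ)) (I' := 𝓡 n) (s := Icc u v) (x := s) (c := x)) (1 : ℝ)

theorem graphCurve_vertical (h : RMetric n M) (om : LinField (𝓡 n) M) (x : M) {s t : ℝ}
    (hst : s < t) : GraphCurve h om (s, x) (t, x) := by
  refine ⟨hst, fun _ ↦ x, SmoothArcWith.piecewise ⟨contMDiffOn_const, fun s' _ ↦ ?_⟩, rfl, rfl⟩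
  have : finsler h om x (0 : EuclideanSpace ℝ (Fin n)) < 1 := by
    rw [show finsler h om x (0 : EuclideanSpace ℝ (Fin n)) = 0 from finsler_zero h om x]
    exact one_pos
  exact (congrArg (fun w : EuclideanSpace ℝ (Fin n) ↦ finsler h om x w)
    (mfderivWithin_const_apply x)).trans_lt this

/-- The graph of a curve of Randers speed less than `1` is timelike for `g_cl`. -/
theorem GraphCurve.chron (h₁ : GraphCurve h om p q) :
    Chron partialT (statMetric h om fun _ ↦ 1) p q := by
  obtain ⟨hpq, c, hc, hp, hq⟩ := h₁
  refine ⟨p.1, q.1, fun s ↦ (s, c s), hpq, ?_, Prod.ext rfl hp, Prod.ext rfl hq⟩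
  refine hc.of_arcs fun u v hu huv hv harc ↦ ⟨contMDiffOn_id.prodMk harc.1, fun s hs ↦ ?_⟩
  refine (futureTimelike_statMetric_iff h om (fun _ ↦ one_pos) _ _).2 ?_
  have hd := mfderivWithin_prodMk (I := 𝓘(ℝ, ℝ)) (I' := 𝓘(ℝ, ℝ)) (I'' := 𝓡 n) (x := s)
    (f := fun s : ℝ ↦ s) (g := c) (s := Icc u v) mdifferentiableWithinAt_id
    ((harc.1 s hs).mdifferentiableWithinAt (by simp)) (uniqueMDiffWithinAt_Icc_of_lt huv hs)
  have hd1 := DFunLike.congr_fun hd (1 : ℝ)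
  have hid : mfderivWithin 𝓘(ℝ, ℝ) 𝓘(ℝ, ℝ) (fun s : ℝ ↦ s) (Icc u v) s (1 : ℝ) = (1 : ℝ) :=
    DFunLike.congr_fun (mfderivWithin_id (I := 𝓘(ℝ, ℝ)) (uniqueMDiffWithinAt_Icc_of_lt huv hs))
      (1 : ℝ)
  have hdt : dt (n := n) (s, c s)
      (mfderivWithin 𝓘(ℝ, ℝ) (prodModel n) (fun s ↦ (s, c s)) (Icc u v) s (1 : ℝ)) = 1 := by
    rw [dt_apply]
    exact (congrArg Prod.fst hd1).trans hid
  have hdpi : dpi (n := n) (s, c s)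
      (mfderivWithin 𝓘(ℝ, ℝ) (prodModel n) (fun s ↦ (s, c s)) (Icc u v) s (1 : ℝ)) =
        mfderivWithin 𝓘(ℝ, ℝ) (𝓡 n) c (Icc u v) s (1 : ℝ) := by
    rw [dpi_apply]
    exact congrArg Prod.snd hd1
  rw [hdt, hdpi, one_mul]
  exact harc.2 s hs

theorem continuous_tangentBundle_mk {E : Type*} [NormedAddCommGroup E] [NormedSpace ℝ E] :
    Continuous fun z : E × E ↦ (⟨z.1, z.2⟩ : TangentBundle 𝓘(ℝ, E) E) :=
  (tangentBundleModelSpaceHomeomorph 𝓘(ℝ, E)).symm.continuous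

theorem continuousOn_finsler_mfderivWithin (h : RMetric n M) (hom : IsSmoothOneForm (𝓡 n) om)
    {E : Type*} [NormedAddCommGroup E] [NormedSpace ℝ E] {f : E → M} {s : Set E}
    (hf : ContMDiffOn 𝓘(ℝ, E) (𝓡 n) ∞ f s) (hs : UniqueDiffOn ℝ s) :
    ContinuousOn (fun z : E × E ↦ finsler h om (f z.1) (mfderivWithin 𝓘(ℝ, E) (𝓡 n) f s z.1 z.2))
      (s ×ˢ univ) := by
  have h1 : ContinuousOn (tangentMapWithin 𝓘(ℝ, E) (𝓡 n) f s)
      (TotalSpace.proj ⁻¹' s) := hf.continuousOn_tangentMapWithin (by simp) hs.uniqueMDiffOn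
  have h3 : ContinuousOn (fun z : E × E ↦ tangentMapWithin 𝓘(ℝ, E) (𝓡 n) f s ⟨z.1, z.2⟩)
      (s ×ˢ univ) := h1.comp continuous_tangentBundle_mk.continuousOn fun z hz ↦ hz.1
  have hF := continuous_finsler h hom
  exact (hF.comp_continuousOn h3).congr fun z _ ↦ rfl

/-- The Randers speed of a smooth arc is continuous up to the endpoints. -/
theorem SmoothArcWith.continuousOn_finsler (h : RMetric n M) (hom : IsSmoothOneForm (𝓡 n) om)
    {K : ℝ → ∀ x : M, TangentSpace (𝓡 n) x → Prop} {c : ℝ → M} {u v : ℝ} (huv : u < v)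
    (hc : SmoothArcWith K c u v) :
    ContinuousOn
      (fun s ↦ finsler h om (c s) (mfderivWithin 𝓘(ℝ, ℝ) (𝓡 n) c (Icc u v) s (1 : ℝ)))
      (Icc u v) :=
  (continuousOn_finsler_mfderivWithin h hom hc.1 (uniqueDiffOn_Icc huv)).comp
    (f := fun s : ℝ ↦ (s, (1 : ℝ))) (by fun_prop) fun _ hs ↦ ⟨hs, trivial⟩

/-- Nearby points are joined by short curves: straight segments in a chart. -/
theorem eventually_graphCurve (hom : IsSmoothOneForm (𝓡 n) om) (x : M) {ε : ℝ} (hε : 0 < ε) :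
    ∀ᶠ y in 𝓝 x, GraphCurve h om (0, x) (ε, y) ∧ GraphCurve h om (0, y) (ε, x) := by
  set E := EuclideanSpace ℝ (Fin n)
  set e := extChartAt (𝓡 n) x
  have hopen : IsOpen e.target := isOpen_extChartAt_target x
  have hsm : ContMDiffOn 𝓘(ℝ, E) (𝓡 n) ∞ e.symm e.target := contMDiffOn_extChartAt_symm x
  -- the Randers norm of the image under the inverse chart of the vector `w` at `z`
  let G : E × E → ℝ := fun z ↦
    finsler h om (e.symm z.1) (mfderivWithin 𝓘(ℝ, E) (𝓡 n) e.symm e.target z.1 z.2)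
  have hG : ContinuousOn G (e.target ×ˢ univ) :=
    continuousOn_finsler_mfderivWithin h hom hsm hopen.uniqueDiffOn
  have hx0 : e x ∈ e.target := mem_extChartAt_target x
  have hG0 : G (e x, 0) < 1 := by
    have : G (e x, 0) = finsler h om (e.symm (e x)) 0 :=
      congrArg (fun w : E ↦ finsler h om (e.symm (e x)) w)
        (map_zero (mfderivWithin 𝓘(ℝ, E) (𝓡 n) e.symm e.target (e x)))
    rw [this, finsler_zero]
    exact one_pos
  have hnhds : ∀ᶠ z in 𝓝 (e x, (0 : E)), z.1 ∈ e.target ∧ G z < 1 := by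
    have hO : e.target ×ˢ (univ : Set E) ∈ 𝓝 (e x, (0 : E)) :=
      (hopen.prod isOpen_univ).mem_nhds ⟨hx0, trivial⟩
    have := (hG.continuousAt hO).eventually (gt_mem_nhds hG0)
    filter_upwards [this, hO] with z hz hz'
    exact ⟨hz'.1, hz⟩
  obtain ⟨ρ, hρ, hball⟩ := Metric.eventually_nhds_iff_ball.1 hnhds
  have key : ∀ y y' : E, y ∈ Metric.ball (e x) ρ → y' ∈ Metric.ball (e x) ρ →
      ‖y' - y‖ < ρ * ε → GraphCurve h om (0, e.symm y) (ε, e.symm y') := by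
    intro y y' hy hy' hyy'
    have hmem : ∀ s ∈ Icc 0 ε, y + (s / ε) • (y' - y) ∈ Metric.ball (e x) ρ := by
      intro s hs
      refine (convex_ball (e x) ρ).add_smul_sub_mem hy hy' ⟨div_nonneg hs.1 hε.le, ?_⟩
      exact (div_le_one hε).2 hs.2
    have hw : ‖ε⁻¹ • (y' - y)‖ < ρ := by
      rw [norm_smul, norm_inv, Real.norm_of_nonneg hε.le, inv_mul_lt_iff₀ hε]
      linarith
    have hgood : ∀ s ∈ Icc 0 ε, y + (s / ε) • (y' - y) ∈ e.target ∧
        G (y + (s / ε) • (y' - y), ε⁻¹ • (y' - y)) < 1 := by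
      intro s hs
      refine hball (_, _) ?_
      rw [← ball_prod_same]
      exact ⟨hmem s hs, by simpa using hw⟩
    have hmaps : MapsTo (fun s : ℝ ↦ y + (s / ε) • (y' - y)) (Icc 0 ε) e.target :=
      fun s hs ↦ (hgood s hs).1
    have hη : ContMDiff 𝓘(ℝ, ℝ) 𝓘(ℝ, E) ∞ (fun s : ℝ ↦ y + (s / ε) • (y' - y)) := by
      apply ContDiff.contMDiff
      fun_prop
    refine ⟨hε, fun s ↦ e.symm (y + (s / ε) • (y' - y)),
      SmoothArcWith.piecewise ⟨hsm.comp hη.contMDiffOn hmaps, fun s hs ↦ ?_⟩, ?_, ?_⟩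
    · have hcomp := mfderivWithin_comp (I := 𝓘(ℝ, ℝ)) (I' := 𝓘(ℝ, E)) (I'' := 𝓡 n) (x := s)
        (f := fun s : ℝ ↦ y + (s / ε) • (y' - y)) (g := e.symm) (s := Icc 0 ε) (u := e.target)
        ((hsm _ (hmaps hs)).mdifferentiableWithinAt (by simp))
        (hη.mdifferentiable (by simp) s).mdifferentiableWithinAt hmaps
        (uniqueMDiffWithinAt_Icc_of_lt hε hs)
      have hder : HasDerivAt (fun s : ℝ ↦ y + (s / ε) • (y' - y)) (ε⁻¹ • (y' - y)) s := by
        have := (((hasDerivAt_id s).div_const ε).smul_const (y' - y)).const_add y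
        simpa using this
      have hd : mfderivWithin 𝓘(ℝ, ℝ) 𝓘(ℝ, E) (fun s : ℝ ↦ y + (s / ε) • (y' - y)) (Icc 0 ε) s
          (1 : ℝ) = ε⁻¹ • (y' - y) := by
        have : fderivWithin ℝ (fun s : ℝ ↦ y + (s / ε) • (y' - y)) (Icc 0 ε) s (1 : ℝ) =
            ε⁻¹ • (y' - y) := by
          rw [(hder.hasFDerivAt.hasFDerivWithinAt).fderivWithin (uniqueDiffOn_Icc hε s hs)]
          simp
        exact (DFunLike.congr_fun mfderivWithin_eq_fderivWithin (1 : ℝ)).trans this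
      have hv : mfderivWithin 𝓘(ℝ, ℝ) (𝓡 n) (fun s : ℝ ↦ e.symm (y + (s / ε) • (y' - y)))
          (Icc 0 ε) s (1 : ℝ) = mfderivWithin 𝓘(ℝ, E) (𝓡 n) e.symm e.target
            (y + (s / ε) • (y' - y)) (ε⁻¹ • (y' - y)) :=
        (DFunLike.congr_fun hcomp (1 : ℝ)).trans (congrArg (mfderivWithin 𝓘(ℝ, E) (𝓡 n) e.symm
          e.target (y + (s / ε) • (y' - y))) hd)
      rw [hv]
      exact (hgood s hs).2
    · simp
    · simp [hε.ne']
  have hcont : Tendsto e (𝓝 x) (𝓝 (e x)) := continuousAt_extChartAt x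
  filter_upwards [hcont.eventually (Metric.ball_mem_nhds _ hρ),
    hcont.eventually (Metric.ball_mem_nhds _ (mul_pos hρ hε)),
    extChartAt_source_mem_nhds (I := 𝓡 n) x] with y hy hy' hys
  have hyb : ‖e y - e x‖ < ρ * ε := by simpa [dist_eq_norm] using hy'
  have hxs : e.symm (e x) = x := extChartAt_to_inv x
  have hys' : e.symm (e y) = y := e.left_inv hys
  constructor
  · simpa only [hxs, hys'] using key (e x) (e y) (Metric.mem_ball_self hρ) hy hyb
  · simpa only [hxs, hys'] using key (e y) (e x) hy (Metric.mem_ball_self hρ)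
      (by rwa [norm_sub_rev])

end Graph

/-! ### The generalized distance and the chronological relations -/

section Dist

variable {n : ℕ} {M : Type*} [TopologicalSpace M] [ChartedSpace (EuclideanSpace ℝ (Fin n)) M]
  [IsManifold (𝓡 n) ∞ M] {h : RMetric n M} {om : LinField (𝓡 n) M}

/-- The Randers speed of a smooth arc extends to a continuous function `ψ` on the line, which can
replace the two-sided speed (possibly undefined at the endpoints) under the integral sign. -/
theorem SmoothArcWith.exists_speed (h : RMetric n M) (hom : IsSmoothOneForm (𝓡 n) om)
    {K : ℝ → ∀ x : M, TangentSpace (𝓡 n) x → Prop} {c : ℝ → M} {u v : ℝ} (huv : u < v)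
    (hc : SmoothArcWith K c u v) :
    ∃ ψ : ℝ → ℝ, Continuous ψ ∧ SmoothArcWith (fun s x w ↦ finsler h om x w = ψ s) c u v ∧
      IntervalIntegrable (fun s ↦ finsler h om (c s) (mfderiv 𝓘(ℝ, ℝ) (𝓡 n) c s (1 : ℝ)))
        MeasureTheory.volume u v ∧
      finslerLength h om c u v = ∫ s in u..v, ψ s := by
  have hcont := hc.continuousOn_finsler h hom huv
  set φ : ℝ → ℝ := fun s ↦
    finsler h om (c s) (mfderivWithin 𝓘(ℝ, ℝ) (𝓡 n) c (Icc u v) s (1 : ℝ))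
  have hψc : Continuous (IccExtend huv.le ((Icc u v).domRestrict φ)) :=
    (continuousOn_iff_continuous_domRestrict.1 hcont).Icc_extend'
  have hval : ∀ s ∈ Icc u v, φ s = IccExtend huv.le ((Icc u v).domRestrict φ) s :=
    fun s hs ↦ (IccExtend_of_mem huv.le ((Icc u v).domRestrict φ) hs).symm
  generalize IccExtend huv.le ((Icc u v).domRestrict φ) = ψ at hψc hval
  refine ⟨ψ, hψc, ?_⟩
  have heq : EqOn (fun s ↦ finsler h om (c s) (mfderiv 𝓘(ℝ, ℝ) (𝓡 n) c s (1 : ℝ))) ψ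
      (Ioo u v) := by
    intro s hs
    simp only [← hval s (Ioo_subset_Icc_self hs), φ]
    rw [mfderivWithin_of_mem_nhds (Icc_mem_nhds hs.1 hs.2)]
  refine ⟨⟨hc.1, hval⟩, ?_, ?_⟩
  · refine (hψc.intervalIntegrable u v).congr_uIoo ?_
    rw [uIoo_of_le huv.le]
    exact heq.symm
  · exact intervalIntegral.integral_congr_Ioo_of_le huv.le heq

theorem bddBelow_lengths (h : RMetric n M) (om : LinField (𝓡 n) M) (x y : M) :
    BddBelow {L : ℝ | ∃ (s₀ s₁ : ℝ) (c : ℝ → M), s₀ < s₁ ∧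
      PiecewiseSmoothWith (𝓡 n) (fun _ _ _ ↦ True) c s₀ s₁ ∧ c s₀ = x ∧ c s₁ = y ∧
      L = finslerLength h om c s₀ s₁} := by
  refine ⟨0, ?_⟩
  rintro L ⟨s₀, s₁, c, hlt, -, -, -, rfl⟩
  exact intervalIntegral.integral_nonneg hlt.le fun s _ ↦ finsler_nonneg h om _ _

theorem finslerDist_nonneg (h : RMetric n M) (om : LinField (𝓡 n) M) (x y : M) :
    0 ≤ finslerDist h om x y := by
  refine Real.sInf_nonneg ?_
  rintro L ⟨s₀, s₁, c, hlt, -, -, -, rfl⟩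
  exact intervalIntegral.integral_nonneg hlt.le fun s _ ↦ finsler_nonneg h om _ _

/-- Along a smooth arc that is timelike for `g_α`, the Randers length of the projection is less
than the increment of `∫ ds / α(s)`. -/
theorem SmoothArcWith.length_lt {α : ℝ → ℝ} (hom : IsSmoothOneForm (𝓡 n) om)
    (hα : Continuous α) (hpos : ∀ t, 0 < α t) {γ : ℝ → ℝ × M} {u v : ℝ} (huv : u < v)
    (hγ : SmoothArcWith (I := prodModel n)
      (fun _ ↦ FutureTimelike (statMetric h om α) partialT) γ u v) :
    IntervalIntegrable (fun s ↦ finsler h om (γ s).2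
        (mfderiv 𝓘(ℝ, ℝ) (𝓡 n) (fun s ↦ (γ s).2) s (1 : ℝ))) MeasureTheory.volume u v ∧
      finslerLength h om (fun s ↦ (γ s).2) u v <
        (∫ s in (0 : ℝ)..(γ v).1, 1 / α s) - ∫ s in (0 : ℝ)..(γ u).1, 1 / α s := by
  have hsnd : ContMDiffOn 𝓘(ℝ, ℝ) (𝓡 n) ∞ (fun s ↦ (γ s).2) (Icc u v) :=
    contMDiff_snd.comp_contMDiffOn hγ.1
  have hfst : ContMDiffOn 𝓘(ℝ, ℝ) 𝓘(ℝ, ℝ) ∞ (fun s ↦ (γ s).1) (Icc u v) :=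
    contMDiff_fst.comp_contMDiffOn hγ.1
  have harc : SmoothArcWith (I := 𝓡 n) (fun _ _ _ ↦ True) (fun s ↦ (γ s).2) u v :=
    ⟨hsnd, fun _ _ ↦ trivial⟩
  obtain ⟨ψ, hψ, hψarc, hint, hlen⟩ := harc.exists_speed h hom huv
  refine ⟨hint, ?_⟩
  rw [hlen]
  have hβ : Continuous fun s ↦ 1 / α s := continuous_const.div hα fun s ↦ (hpos s).ne'
  have hderiv : ∀ s ∈ Ioo u v, ∃ τ' : ℝ, HasDerivAt (fun s ↦ (γ s).1) τ' s ∧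
      α (γ s).1 * ψ s < τ' := by
    intro s hs
    have hs' := Ioo_subset_Icc_self hs
    have hmd := (hγ.1 s hs').mdifferentiableWithinAt (by simp)
    have huniq := uniqueMDiffWithinAt_Icc_of_lt huv hs'
    have hd1 := DFunLike.congr_fun (mfderiv_comp_mfderivWithin (I := 𝓘(ℝ, ℝ)) (I' := prodModel n)
      (I'' := 𝓘(ℝ, ℝ)) (g := (Prod.fst : ℝ × M → ℝ)) s mdifferentiableAt_fst hmd huniq) (1 : ℝ)
    have hd2 := DFunLike.congr_fun (mfderiv_comp_mfderivWithin (I := 𝓘(ℝ, ℝ)) (I' := prodModel n)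
      (I'' := 𝓡 n) (g := (Prod.snd : ℝ × M → M)) s mdifferentiableAt_snd hmd huniq) (1 : ℝ)
    have htl := (futureTimelike_statMetric_iff h om hpos _ _).1 (hγ.2 s hs')
    have hd1' : mfderivWithin 𝓘(ℝ, ℝ) 𝓘(ℝ, ℝ) (fun s ↦ (γ s).1) (Icc u v) s (1 : ℝ) =
        dt (γ s) (mfderivWithin 𝓘(ℝ, ℝ) (prodModel n) γ (Icc u v) s (1 : ℝ)) := hd1
    have hd2' : mfderivWithin 𝓘(ℝ, ℝ) (𝓡 n) (fun s ↦ (γ s).2) (Icc u v) s (1 : ℝ) =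
        dpi (γ s) (mfderivWithin 𝓘(ℝ, ℝ) (prodModel n) γ (Icc u v) s (1 : ℝ)) := hd2
    have hτ : derivWithin (fun s ↦ (γ s).1) (Icc u v) s =
        dt (γ s) (mfderivWithin 𝓘(ℝ, ℝ) (prodModel n) γ (Icc u v) s (1 : ℝ)) := by
      rw [← hd1', ← fderivWithin_derivWithin]
      exact (DFunLike.congr_fun mfderivWithin_eq_fderivWithin (1 : ℝ)).symm
    refine ⟨derivWithin (fun s ↦ (γ s).1) (Icc u v) s, ?_, ?_⟩
    · have hdiff : DifferentiableWithinAt ℝ (fun s ↦ (γ s).1) (Icc u v) s :=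
        ((hfst s hs').mdifferentiableWithinAt (by simp)).differentiableWithinAt
      exact hdiff.hasDerivWithinAt.hasDerivAt (Icc_mem_nhds hs.1 hs.2)
    · rw [hτ, ← hψarc.2 s hs']
      rwa [← hd2'] at htl
  -- on `[u, s]`, the increment of `∫ dr / α(r)` exceeds the length by more and more as `s` grows
  have hmono : StrictMonoOn (fun s ↦ (∫ r in (0 : ℝ)..(γ s).1, 1 / α r) - ∫ r in u..s, ψ r)
      (Icc u v) := by
    refine strictMonoOn_of_deriv_pos (convex_Icc u v) ?_ ?_
    · have h1 : Continuous fun t : ℝ ↦ ∫ r in (0 : ℝ)..t, 1 / α r :=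
        intervalIntegral.continuous_primitive (fun a b ↦ hβ.intervalIntegrable a b) 0
      have h2 : Continuous fun t : ℝ ↦ ∫ r in u..t, ψ r :=
        intervalIntegral.continuous_primitive (fun a b ↦ hψ.intervalIntegrable a b) u
      exact (h1.comp_continuousOn hfst.continuousOn).sub h2.continuousOn
    · intro s hs
      rw [interior_Icc] at hs
      obtain ⟨τ', hτ', hlt⟩ := hderiv s hs
      have hA : HasDerivAt (fun t : ℝ ↦ ∫ r in (0 : ℝ)..t, 1 / α r) (1 / α (γ s).1) (γ s).1 :=
        hβ.integral_hasStrictDerivAt 0 _ |>.hasDerivAt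
      have hB : HasDerivAt (fun t : ℝ ↦ ∫ r in u..t, ψ r) (ψ s) s :=
        hψ.integral_hasStrictDerivAt u s |>.hasDerivAt
      have hAτ : HasDerivAt (fun s ↦ ∫ r in (0 : ℝ)..(γ s).1, 1 / α r) (1 / α (γ s).1 * τ') s :=
        HasDerivAt.comp (h₂ := fun t : ℝ ↦ ∫ r in (0 : ℝ)..t, 1 / α r) (h := fun s ↦ (γ s).1) s
          hA hτ'
      have hAB := hAτ.sub hB
      have hpos' : 0 < 1 / α (γ s).1 * τ' - ψ s := by
        rw [sub_pos, one_div, lt_inv_mul_iff₀ (hpos _)]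
        exact hlt
      have := hAB.deriv
      rw [← this] at hpos'
      exact hpos'
  have := hmono (left_mem_Icc.2 huv.le) (right_mem_Icc.2 huv.le) huv
  simp only [intervalIntegral.integral_same, sub_zero] at this
  linarith

theorem Chron.finslerDist_lt {α : ℝ → ℝ} (hom : IsSmoothOneForm (𝓡 n) om) (hα : Continuous α)
    (hpos : ∀ t, 0 < α t) {p q : ℝ × M} (hpq : Chron partialT (statMetric h om α) p q) :
    finslerDist h om p.2 q.2 < (∫ s in (0 : ℝ)..q.1, 1 / α s) - ∫ s in (0 : ℝ)..p.1, 1 / α s := by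
  obtain ⟨a, b, γ, hab, hγ, rfl, rfl⟩ := hpq
  have hlt := hγ.induction_arcs hab (Q := fun u v ↦
    IntervalIntegrable (fun s ↦ finsler h om (γ s).2
        (mfderiv 𝓘(ℝ, ℝ) (𝓡 n) (fun s ↦ (γ s).2) s (1 : ℝ))) MeasureTheory.volume u v ∧
      finslerLength h om (fun s ↦ (γ s).2) u v <
        (∫ s in (0 : ℝ)..(γ v).1, 1 / α s) - ∫ s in (0 : ℝ)..(γ u).1, 1 / α s)
    (fun u v _ huv _ harc ↦ harc.length_lt hom hα hpos huv) (by
      rintro u v w - - ⟨i1, l1⟩ ⟨i2, l2⟩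
      refine ⟨i1.trans i2, ?_⟩
      have := intervalIntegral.integral_add_adjacent_intervals i1 i2
      unfold finslerLength at l1 l2 ⊢
      linarith)
  refine (csInf_le (bddBelow_lengths h om _ _)
    ⟨a, b, fun s ↦ (γ s).2, hab, ?_, rfl, rfl, rfl⟩).trans_lt hlt.2
  exact hγ.of_arcs fun u v _ _ _ harc ↦
    ⟨contMDiff_snd.comp_contMDiffOn harc.1, fun _ _ ↦ trivial⟩

theorem GraphCurve.mono_time {p : ℝ × M} {x : M} {t t' : ℝ} (h₁ : GraphCurve h om p (t, x))
    (htt : t ≤ t') : GraphCurve h om p (t', x) := by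
  rcases htt.eq_or_lt with rfl | hlt
  · exact h₁
  · exact h₁.trans (graphCurve_vertical h om x hlt)

theorem GraphCurve.add {x y z : M} {a b : ℝ} (h₁ : GraphCurve h om (0, x) (a, y))
    (h₂ : GraphCurve h om (0, y) (b, z)) : GraphCurve h om (0, x) (a + b, z) := by
  have := h₂.translate a
  simp only [zero_add] at this
  rw [add_comm b a] at this
  exact h₁.trans this

/-- An arc of Randers speed less than `m`, reparametrized linearly. -/
theorem SmoothArcWith.graphCurve {c : ℝ → M} {u v m : ℝ} (huv : u < v) (hm : 0 < m)
    (hc : SmoothArcWith (fun _ x w ↦ finsler h om x w < m) c u v) :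
    GraphCurve h om (0, c u) (m * (v - u), c v) := by
  have hpos : 0 < m * (v - u) := mul_pos hm (by linarith)
  have e : m⁻¹ * (m * (v - u)) + u = v := by field_simp; ring
  refine ⟨hpos, fun s ↦ c (m⁻¹ * s + u),
    (SmoothArcWith.comp_affine (K := fun _ x w ↦ finsler h om x w < m) (inv_pos.2 hm) hpos ?_
      ?_).piecewise, ?_, ?_⟩
  · rw [e]
    simpa using hc
  · intro s _ x w hw
    rw [finsler_smul h om x w (inv_pos.2 hm).le, inv_mul_lt_iff₀ hm, mul_one]
    exact hw
  · simp
  · change c (m⁻¹ * (m * (v - u)) + u) = c v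
    rw [e]

/-- A smooth arc of Randers length `L` can be reparametrized, piecewise linearly on a fine
subdivision, so as to have speed less than `1` on an interval of length `L + δ(v - u)`. -/
theorem SmoothArcWith.graphCurve_integral {c : ℝ → M} {ψ : ℝ → ℝ} {u v δ : ℝ} (hψ : Continuous ψ)
    (huv : u < v) (hc : SmoothArcWith (fun s x w ↦ finsler h om x w = ψ s) c u v)
    (hδ : 0 < δ) :
    GraphCurve h om (0, c u) ((∫ s in u..v, ψ s) + δ * (v - u), c v) := by
  have huc := isCompact_Icc.uniformContinuousOn_of_continuous (hψ.continuousOn (s := Icc u v))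
  obtain ⟨η, hη, hηψ⟩ := Metric.uniformContinuousOn_iff.1 huc (δ / 2) (half_pos hδ)
  have hψ0 : ∀ s ∈ Icc u v, 0 ≤ ψ s := fun s hs ↦ by
    rw [← hc.2 s hs]
    exact finsler_nonneg h om _ _
  have base : ∀ s s', u ≤ s → s < s' → s' ≤ v → s' - s < η →
      GraphCurve h om (0, c s) ((∫ r in s..s', ψ r) + δ * (s' - s), c s') := by
    intro s s' hus hss hsv hsη
    have hs0 : s ∈ Icc u v := ⟨hus, hss.le.trans hsv⟩
    have hclose : ∀ r ∈ Icc s s', |ψ r - ψ s| < δ / 2 := fun r hr ↦ by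
      refine hηψ r ⟨hus.trans hr.1, hr.2.trans hsv⟩ s hs0 ?_
      rw [Real.dist_eq, abs_of_nonneg (by linarith [hr.1])]
      linarith [hr.2]
    have harc : SmoothArcWith (fun _ x w ↦ finsler h om x w < ψ s + δ / 2) c s s' :=
      (hc.mono hus hss hsv).imp fun r hr x w hw ↦ by
        rw [hw]
        linarith [(abs_lt.1 (hclose r hr)).2]
    refine (harc.graphCurve hss (by linarith [hψ0 s hs0])).mono_time ?_
    have hle : (ψ s - δ / 2) * (s' - s) ≤ ∫ r in s..s', ψ r := by
      have := intervalIntegral.integral_mono_on hss.le (by simp) (hψ.intervalIntegrable s s')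
        (f := fun _ ↦ ψ s - δ / 2) (μ := MeasureTheory.volume)
        fun r hr ↦ by linarith [(abs_lt.1 (hclose r hr)).1]
      rw [intervalIntegral.integral_const, smul_eq_mul] at this
      linarith
    linarith
  -- longer subarcs are cut into steps of length `η / 2`, up to a last one shorter than `η`
  have main : ∀ (k : ℕ) (s s' : ℝ), u ≤ s → s < s' → s' ≤ v → s' - s ≤ k * (η / 2) →
      GraphCurve h om (0, c s) ((∫ r in s..s', ψ r) + δ * (s' - s), c s') := by
    intro k
    induction k with
    | zero =>
      intro s s' _ hss _ hk
      simp only [Nat.cast_zero, zero_mul] at hk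
      linarith
    | succ k ih =>
      intro s s' hus hss hsv hk
      rcases lt_or_ge (s' - s) η with hlt | hge
      · exact base s s' hus hss hsv hlt
      · push_cast at hk
        have h1 := base s (s + η / 2) hus (by linarith) (by linarith) (by linarith)
        have h2 := ih (s + η / 2) s' (by linarith) (by linarith) hsv (by linarith)
        have h3 := intervalIntegral.integral_add_adjacent_intervals
          (hψ.intervalIntegrable (μ := MeasureTheory.volume) s (s + η / 2))
          (hψ.intervalIntegrable (s + η / 2) s')
        have h4 := h1.add h2
        rw [← h3]
        convert h4 using 2
        ring
  obtain ⟨k, hk⟩ := exists_nat_ge ((v - u) / (η / 2))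
  exact main k u v le_rfl huv le_rfl ((div_le_iff₀ (half_pos hη)).1 hk)

theorem graphCurve_of_length (hom : IsSmoothOneForm (𝓡 n) om) {c : ℝ → M} {a b : ℝ} (hab : a < b)
    (hc : PiecewiseSmoothWith (𝓡 n) (fun _ _ _ ↦ True) c a b) {ε : ℝ} (hε : 0 < ε) :
    GraphCurve h om (0, c a) (finslerLength h om c a b + ε, c b) := by
  have := hc.induction_arcs hab (Q := fun u v ↦
    IntervalIntegrable (fun s ↦ finsler h om (c s)
        (mfderiv 𝓘(ℝ, ℝ) (𝓡 n) c s (1 : ℝ))) MeasureTheory.volume u v ∧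
      ∀ ε : ℝ, 0 < ε → GraphCurve h om (0, c u) (finslerLength h om c u v + ε, c v)) ?_ ?_
  · exact this.2 ε hε
  · intro u v _ huv _ harc
    obtain ⟨ψ, hψ, hψarc, hint, hlen⟩ := harc.exists_speed h hom huv
    refine ⟨hint, fun ε hε ↦ ?_⟩
    have := hψarc.graphCurve_integral hψ huv (δ := ε / (v - u)) (div_pos hε (by linarith))
    rwa [div_mul_cancel₀ _ (by linarith), ← hlen] at this
  · rintro u v w - - ⟨i1, g1⟩ ⟨i2, g2⟩
    refine ⟨i1.trans i2, fun ε hε ↦ ?_⟩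
    have := (g1 (ε / 2) (half_pos hε)).add (g2 (ε / 2) (half_pos hε))
    have hadd : finslerLength h om c u v + finslerLength h om c v w = finslerLength h om c u w :=
      intervalIntegral.integral_add_adjacent_intervals i1 i2
    convert this using 2
    linarith

theorem exists_graphCurve [ConnectedSpace M] (h : RMetric n M) (hom : IsSmoothOneForm (𝓡 n) om)
    (x y : M) : ∃ t, GraphCurve h om (0, x) (t, y) := by
  refine PreconnectedSpace.induction₂' (fun x y ↦ ∃ t, GraphCurve h om (0, x) (t, y)) ?_ ?_ x y
  · intro x
    filter_upwards [eventually_graphCurve (h := h) hom x one_pos] with y hy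
    exact ⟨⟨1, hy.1⟩, ⟨1, hy.2⟩⟩
  · exact ⟨fun x y z ⟨s, hs⟩ ⟨t, ht⟩ ↦ ⟨s + t, hs.add ht⟩⟩

theorem graphCurve_of_finslerDist_lt [ConnectedSpace M] (hom : IsSmoothOneForm (𝓡 n) om)
    {p q : ℝ × M} (hd : finslerDist h om p.2 q.2 < q.1 - p.1) : GraphCurve h om p q := by
  have hne : {L : ℝ | ∃ (s₀ s₁ : ℝ) (c : ℝ → M), s₀ < s₁ ∧
      PiecewiseSmoothWith (𝓡 n) (fun _ _ _ ↦ True) c s₀ s₁ ∧ c s₀ = p.2 ∧ c s₁ = q.2 ∧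
      L = finslerLength h om c s₀ s₁}.Nonempty := by
    obtain ⟨t, ht, c, hc, h0, h1⟩ := exists_graphCurve h hom p.2 q.2
    exact ⟨_, 0, t, c, ht, hc.imp fun _ _ _ _ _ ↦ trivial, h0, h1, rfl⟩
  obtain ⟨L, ⟨s₀, s₁, c, hlt, hc, h0, h1, rfl⟩, hL⟩ := exists_lt_of_csInf_lt hne hd
  have := (graphCurve_of_length (h := h) hom hlt hc
    (ε := q.1 - p.1 - finslerLength h om c s₀ s₁) (by linarith)).translate p.1
  rw [h0, h1] at this
  convert this using 1
  · simp
  · ext <;> simp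

/-- In the standard stationary spacetime `g_cl` the chronological relation is determined by the
generalized distance. -/
theorem chron_one_iff [ConnectedSpace M] (hom : IsSmoothOneForm (𝓡 n) om) {p q : ℝ × M} :
    Chron partialT (statMetric h om fun _ ↦ 1) p q ↔ finslerDist h om p.2 q.2 < q.1 - p.1 := by
  refine ⟨fun hpq ↦ ?_, fun hd ↦ (graphCurve_of_finslerDist_lt hom hd).chron⟩
  simpa using hpq.finslerDist_lt hom continuous_const fun _ ↦ one_pos

end Dist

section Main

variable {n : ℕ} {M : Type*} [TopologicalSpace M] [ChartedSpace (EuclideanSpace ℝ (Fin n)) M]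
  [IsManifold (𝓡 n) ∞ M] [ConnectedSpace M] {h : RMetric n M} {om : LinField (𝓡 n) M}

theorem finslerDist_triangle (h : RMetric n M) (hom : IsSmoothOneForm (𝓡 n) om) (x y z : M) :
    finslerDist h om x z ≤ finslerDist h om x y + finslerDist h om y z := by
  refine le_of_forall_pos_lt_add fun ε hε ↦ ?_
  have h1 : Chron partialT (statMetric h om fun _ ↦ 1) ((0 : ℝ), x)
      (finslerDist h om x y + ε / 2, y) := (chron_one_iff hom).2 (by simp [hε])
  have h2 : Chron partialT (statMetric h om fun _ ↦ 1) (finslerDist h om x y + ε / 2, y)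
      (finslerDist h om x y + finslerDist h om y z + ε, z) :=
    (chron_one_iff hom).2 (by simp only; linarith)
  simpa using (chron_one_iff hom).1 (h1.trans h2)

theorem isOpen_chronPast_singleton (hom : IsSmoothOneForm (𝓡 n) om) (r : ℝ × M) :
    IsOpen {p | Chron partialT (statMetric h om fun _ ↦ 1) p r} := by
  rw [isOpen_iff_mem_nhds]
  intro p hp
  have hp' := (chron_one_iff hom).1 hp
  set ε := (r.1 - p.1 - finslerDist h om p.2 r.2) / 2 with hε
  have hε0 : 0 < ε := by rw [hε]; linarith
  have h1 : ∀ᶠ q : ℝ × M in 𝓝 p, q.1 < p.1 + ε :=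
    continuous_fst.continuousAt.eventually (gt_mem_nhds (by linarith))
  have h2 : ∀ᶠ q : ℝ × M in 𝓝 p, finslerDist h om q.2 p.2 < ε := by
    have := (eventually_graphCurve (h := h) hom p.2 hε0).mono
      fun y hy ↦ (chron_one_iff hom).1 hy.2.chron
    filter_upwards [continuous_snd.continuousAt.eventually this] with q hq
    simpa using hq
  filter_upwards [h1, h2] with q hq1 hq2
  refine (chron_one_iff hom).2 ?_
  have := finslerDist_triangle h hom q.2 p.2 r.2
  linarith

theorem chron_one_irrefl (hom : IsSmoothOneForm (𝓡 n) om) (p : ℝ × M) :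
    ¬ Chron partialT (statMetric h om fun _ ↦ 1) p p := fun hp ↦ by
  have := (chron_one_iff hom).1 hp
  linarith [finslerDist_nonneg h om p.2 p.2]

omit [ConnectedSpace M] in
theorem exists_chron_one (h : RMetric n M) (om : LinField (𝓡 n) M) (p : ℝ × M) :
    ∃ q, Chron partialT (statMetric h om fun _ ↦ 1) q p :=
  ⟨(p.1 - 1, p.2), (graphCurve_vertical h om p.2 (by linarith)).chron⟩

/-! ### Pasts with respect to an isocausal metric -/

section IsoCausality

variable {D : SplitSpacetime n M}

omit [ConnectedSpace M] in
theorem SplitSpacetime.chron_of_chron_one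
    (hcl : ConesWider partialT (statMetric h om fun _ ↦ 1) D.metric) {p q : ℝ × M}
    (hpq : Chron partialT (statMetric h om fun _ ↦ 1) p q) : Chron partialT D.metric p q :=
  hpq.of_timelike_imp (hcl.futureTimelike (statMetric_symm h om _) D.metric_symm
    (statMetric_partialT h om _) D.metric_partialT)

omit [ConnectedSpace M] in
theorem SplitSpacetime.finslerDist_lt_of_chron {α : ℝ → ℝ} (hom : IsSmoothOneForm (𝓡 n) om)
    (hα : Continuous α) (hpos : ∀ t, 0 < α t)
    (hop : ConesWider partialT D.metric (statMetric h om α)) {p q : ℝ × M}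
    (hpq : Chron partialT D.metric p q) :
    finslerDist h om p.2 q.2 < ∫ s in p.1..q.1, 1 / α s := by
  have h1 : Chron partialT (statMetric h om α) p q :=
    hpq.of_timelike_imp (hop.futureTimelike D.metric_symm (statMetric_symm h om _)
      D.metric_partialT (statMetric_partialT h om _))
  have hβ : Continuous fun s ↦ 1 / α s := continuous_const.div hα fun s ↦ (hpos s).ne'
  rw [← intervalIntegral.integral_interval_sub_left (hβ.intervalIntegrable 0 q.1)
    (hβ.intervalIntegrable 0 p.1)]
  exact h1.finslerDist_lt hom hα hpos

omit [ConnectedSpace M] in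
theorem SplitSpacetime.fst_lt_of_chron {α : ℝ → ℝ} (hom : IsSmoothOneForm (𝓡 n) om)
    (hα : Continuous α) (hpos : ∀ t, 0 < α t)
    (hop : ConesWider partialT D.metric (statMetric h om α)) {p q : ℝ × M}
    (hpq : Chron partialT D.metric p q) : p.1 < q.1 := by
  have h1 := D.finslerDist_lt_of_chron hom hα hpos hop hpq
  by_contra! hle
  have h2 : 0 ≤ ∫ s in q.1..p.1, 1 / α s :=
    intervalIntegral.integral_nonneg hle fun s _ ↦ (div_pos one_pos (hpos s)).le
  rw [intervalIntegral.integral_symm] at h1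
  linarith [finslerDist_nonneg h om p.2 q.2]

theorem IsIP.isIP_chronPast (hom : IsSmoothOneForm (𝓡 n) om)
    (hcl : ConesWider partialT (statMetric h om fun _ ↦ 1) D.metric) {P : Set (ℝ × M)}
    (hP : IsIP partialT (statMetric h om fun _ ↦ 1) P) :
    IsIP partialT D.metric (chronPast partialT D.metric P) := by
  refine (isPastSet_chronPast (fun p ↦ ?_) hP.1.1).isIP ?_
  · obtain ⟨q, hq⟩ := exists_chron_one h om p
    exact ⟨q, D.chron_of_chron_one hcl hq⟩
  · rintro p ⟨p', hp', hpp'⟩ q ⟨q', hq', hqq'⟩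
    obtain ⟨r, hr, hpr, hqr⟩ := hP.directed (chron_one_irrefl hom) (exists_chron_one h om) hp' hq'
    obtain ⟨r', hr', hrr'⟩ := hP.1.exists_chron hr
    exact ⟨r, ⟨r', hr', D.chron_of_chron_one hcl hrr'⟩,
      hpp'.trans (D.chron_of_chron_one hcl hpr), hqq'.trans (D.chron_of_chron_one hcl hqr)⟩

end IsoCausality

/-- The integrals of `β` between late points of `T` are small: either `T` is bounded above, and
the primitive of `β` is continuous at its supremum, or `β` is integrable up to infinity. -/
theorem exists_forall_integral_lt {β : ℝ → ℝ} (hβ : Continuous β)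
    (hint : MeasureTheory.IntegrableOn β (Ioi 0)) {T : Set ℝ} (hT : T.Nonempty) {ε : ℝ}
    (hε : 0 < ε) : ∃ t₁ ∈ T, ∀ t ∈ T, ∀ t' ∈ T, t₁ ≤ t → t₁ ≤ t' → ∫ s in t..t', β s < ε := by
  have hsub : ∀ t t', ∫ s in t..t', β s = (∫ s in (0 : ℝ)..t', β s) - ∫ s in (0 : ℝ)..t, β s :=
    fun t t' ↦ (intervalIntegral.integral_interval_sub_left (hβ.intervalIntegrable 0 t')
      (hβ.intervalIntegrable 0 t)).symm
  obtain ⟨L, t₁, ht₁, hL⟩ : ∃ L, ∃ t₁ ∈ T, ∀ t ∈ T, t₁ ≤ t →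
      |(∫ s in (0 : ℝ)..t, β s) - L| < ε / 2 := by
    by_cases hb : BddAbove T
    · have hc : Continuous fun t : ℝ ↦ ∫ s in (0 : ℝ)..t, β s :=
        intervalIntegral.continuous_primitive (fun a b ↦ hβ.intervalIntegrable a b) 0
      obtain ⟨δ, hδ, hδε⟩ := Metric.continuousAt_iff.1 (hc.continuousAt (x := sSup T)) (ε / 2)
        (half_pos hε)
      obtain ⟨t₁, ht₁, hlt⟩ := exists_lt_of_lt_csSup hT (sub_lt_self (sSup T) hδ)
      refine ⟨∫ s in (0 : ℝ)..sSup T, β s, t₁, ht₁, fun t ht hle ↦ hδε ?_⟩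
      have := le_csSup hb ht
      rw [Real.dist_eq, abs_of_nonpos (by linarith)]
      linarith
    · have hlim := MeasureTheory.intervalIntegral_tendsto_integral_Ioi 0 hint tendsto_id
      obtain ⟨N, hN⟩ := eventually_atTop.1 ((Metric.tendsto_nhds.1 hlim) (ε / 2) (half_pos hε))
      obtain ⟨t₁, ht₁, hlt⟩ := not_bddAbove_iff.1 hb N
      exact ⟨_, t₁, ht₁, fun t _ hle ↦ hN t (hlt.le.trans hle)⟩
  refine ⟨t₁, ht₁, fun t ht t' ht' hle hle' ↦ ?_⟩
  rw [hsub]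
  linarith [(abs_lt.1 (hL t ht hle)).1, (abs_lt.1 (hL t' ht' hle')).2]

/-- An indecomposable past set of `g_cl` is contained in every other one with the same past for
`g`. A point of `P` has, after a shift of `ε` to the future, a successor `r ∈ P` that is so late
that beyond it the `g`-cones exceed the `g_cl`-cones by less than `ε` in total. -/
theorem IsIP.subset_of_chronPast_eq {D : SplitSpacetime n M} {α : ℝ → ℝ}
    (hom : IsSmoothOneForm (𝓡 n) om) (hα : Continuous α) (hpos : ∀ t, 0 < α t)
    (hcl : ConesWider partialT (statMetric h om fun _ ↦ 1) D.metric)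
    (hop : ConesWider partialT D.metric (statMetric h om α))
    (hint : MeasureTheory.IntegrableOn (fun s ↦ 1 / α s - 1) (Ioi 0)) {P Q : Set (ℝ × M)}
    (hP : IsIP partialT (statMetric h om fun _ ↦ 1) P)
    (hQ : IsIP partialT (statMetric h om fun _ ↦ 1) Q)
    (hPQ : chronPast partialT D.metric P = chronPast partialT D.metric Q) : P ⊆ Q := by
  intro p hp
  have hβ : Continuous fun s ↦ 1 / α s := continuous_const.div hα fun s ↦ (hpos s).ne'
  have hsub : ∀ R, IsIP partialT (statMetric h om fun _ ↦ 1) R →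
      R ⊆ chronPast partialT D.metric R := fun R hR r hr ↦ by
    obtain ⟨r', hr', hrr'⟩ := hR.1.exists_chron hr
    exact ⟨r', hr', D.chron_of_chron_one hcl hrr'⟩
  obtain ⟨q, hq, hpq⟩ := hP.1.exists_chron hp
  have hd := (chron_one_iff hom).1 hpq
  set ε := (q.1 - p.1 - finslerDist h om p.2 q.2) / 2 with hε
  have hε0 : 0 < ε := by rw [hε]; linarith
  have hpε : (p.1 + ε, p.2) ∈ P :=
    hP.1.mem_of_chron ((chron_one_iff hom).2 (by simp only; linarith)) hq
  obtain ⟨_, ⟨w, hw, rfl⟩, hlate⟩ := exists_forall_integral_lt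
    (β := fun s ↦ 1 / α s - 1) (hβ.sub continuous_const) hint
    (hP.1.1.image Prod.fst) hε0
  obtain ⟨r, hr, hpr, hwr⟩ := hP.directed (chron_one_irrefl hom) (exists_chron_one h om) hpε hw
  obtain ⟨q', hq', hrq'⟩ := hPQ ▸ hsub P hP hr
  have hrq1 := D.fst_lt_of_chron hom hα hpos hop hrq'
  have hwr1 : w.1 < r.1 := by
    linarith [(chron_one_iff hom).1 hwr, finslerDist_nonneg h om w.2 r.2]
  have hq'T : q'.1 ∈ Prod.fst '' P := by
    obtain ⟨p', hp', hqp'⟩ := hPQ.symm ▸ hsub Q hQ hq'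
    exact ⟨(q'.1, p'.2), hP.1.mem_of_chron (graphCurve_vertical h om p'.2
      (D.fst_lt_of_chron hom hα hpos hop hqp')).chron hp', rfl⟩
  have hlt := hlate r.1 ⟨r, hr, rfl⟩ q'.1 hq'T hwr1.le (hwr1.trans hrq1).le
  rw [intervalIntegral.integral_sub (hβ.intervalIntegrable _ _) (by simp)] at hlt
  simp only [intervalIntegral.integral_const, smul_eq_mul, mul_one] at hlt
  have h1 := D.finslerDist_lt_of_chron hom hα hpos hop hrq'
  have h2 := (chron_one_iff hom).1 hpr
  have h3 := finslerDist_triangle h hom p.2 r.2 q'.2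
  refine hQ.1.mem_of_chron ((chron_one_iff hom).2 ?_) hq'
  simp only at h2
  linarith

/-! ### The future completion of the standard stationary spacetime -/

theorem eventually_comap_nhdsLT {Ω : EReal} {t : ℝ} (ht : (t : EReal) < Ω) :
    ∀ᶠ s : ℝ in comap (fun s : ℝ ↦ (s : EReal)) (𝓝[<] Ω), t < s ∧ (s : EReal) < Ω := by
  filter_upwards [preimage_mem_comap (Ioo_mem_nhdsLT ht)] with s hs
  exact ⟨EReal.coe_lt_coe_iff.1 hs.1, hs.2⟩

theorem neBot_comap_nhdsLT {Ω : EReal} {t : ℝ} (ht : (t : EReal) < Ω) :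
    (comap (fun s : ℝ ↦ (s : EReal)) (𝓝[<] Ω)).NeBot := by
  refine comap_neBot fun U hU ↦ ?_
  obtain ⟨l, hl, hlU⟩ := (mem_nhdsLT_iff_exists_Ioo_subset' ht).1 hU
  obtain ⟨s, hs, hs'⟩ := EReal.lt_iff_exists_real_btwn.1 hl
  exact ⟨s, hlU ⟨hs, hs'⟩⟩

theorem isIP_univ (h : RMetric n M) (hom : IsSmoothOneForm (𝓡 n) om) :
    IsIP partialT (statMetric h om fun _ ↦ 1) (univ : Set (ℝ × M)) := by
  have hup : ∀ p : ℝ × M, ∀ x : M, ∀ T : ℝ, p.1 + finslerDist h om p.2 x < T →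
      Chron partialT (statMetric h om fun _ ↦ 1) p (T, x) := fun p x T hT ↦
    (chron_one_iff hom).2 (by simp only; linarith)
  obtain ⟨x⟩ := (inferInstance : Nonempty M)
  refine IsPastSet.isIP ⟨⟨(0, x), trivial⟩, eq_univ_of_forall fun p ↦ ?_⟩ fun p _ q _ ↦ ?_
  · exact ⟨_, trivial, hup p x _ (lt_add_one _)⟩
  · exact ⟨(max (p.1 + finslerDist h om p.2 x) (q.1 + finslerDist h om q.2 x) + 1, x), trivial,
      hup p x _ ((le_max_left _ _).trans_lt (lt_add_one _)),
      hup q x _ ((le_max_right _ _).trans_lt (lt_add_one _))⟩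

theorem IsIP.translate (hom : IsSmoothOneForm (𝓡 n) om) {P : Set (ℝ × M)}
    (hP : IsIP partialT (statMetric h om fun _ ↦ 1) P) (k : ℝ) :
    IsIP partialT (statMetric h om fun _ ↦ 1) {p : ℝ × M | (p.1 - k, p.2) ∈ P} := by
  have hshift : ∀ p q : ℝ × M, Chron partialT (statMetric h om fun _ ↦ 1) (p.1 - k, p.2) q ↔
      Chron partialT (statMetric h om fun _ ↦ 1) p (q.1 + k, q.2) := fun p q ↦ by
    rw [chron_one_iff hom, chron_one_iff hom]
    simp only
    constructor <;> intro h' <;> linarith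
  have hmem : ∀ q ∈ P, (q.1 + k, q.2) ∈ {p : ℝ × M | (p.1 - k, p.2) ∈ P} := fun q hq ↦ by
    simpa using hq
  refine IsPastSet.isIP ⟨?_, Subset.antisymm ?_ ?_⟩ ?_
  · obtain ⟨q, hq⟩ := hP.1.1
    exact ⟨_, hmem q hq⟩
  · rintro p ⟨q, hq, hpq⟩
    refine hP.1.mem_of_chron ?_ hq
    rw [hshift]
    simpa using hpq
  · intro p hp
    obtain ⟨q, hq, hpq⟩ := hP.1.exists_chron hp
    exact ⟨_, hmem q hq, (hshift p q).1 hpq⟩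
  · intro p hp q hq
    obtain ⟨r, hr, hpr, hqr⟩ := hP.directed (chron_one_irrefl hom) (exists_chron_one h om) hp hq
    exact ⟨_, hmem r hr, (hshift p r).1 hpr, (hshift q r).1 hqr⟩

/-- The points `(t, c t)` with `a ≤ t < Ω` form a chronological chain of `g_cl`. This is all that
is needed of a curve `c` on `[a, Ω)` of Randers speed less than `1`. -/
def IsTimelikeGraph (h : RMetric n M) (om : LinField (𝓡 n) M) (a : ℝ) (Ω : EReal) (c : ℝ → M) :
    Prop :=
  ∀ s t : ℝ, a ≤ s → s < t → (t : EReal) < Ω →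
    Chron partialT (statMetric h om fun _ ↦ 1) (s, c s) (t, c t)

omit [ConnectedSpace M] in
theorem isTimelikeGraph_of_piecewiseSmooth {a : ℝ} {Ω : EReal} {c : ℝ → M}
    (hc : ∀ b : ℝ, a < b → (b : EReal) < Ω →
      PiecewiseSmoothWith (𝓡 n) (fun _ x v ↦ finsler h om x v < 1) c a b) :
    IsTimelikeGraph h om a Ω c := fun _ t has hst htΩ ↦
  GraphCurve.chron ⟨hst, c, (hc t (has.trans_lt hst) htΩ).mono has le_rfl, rfl, rfl⟩

theorem IsTimelikeGraph.monotone (hom : IsSmoothOneForm (𝓡 n) om) {a : ℝ} {Ω : EReal} {c : ℝ → M}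
    (hc : IsTimelikeGraph h om a Ω c) (x : M) {s t : ℝ} (has : a ≤ s) (hst : s ≤ t)
    (ht : (t : EReal) < Ω) : s - finslerDist h om x (c s) ≤ t - finslerDist h om x (c t) := by
  rcases hst.eq_or_lt with rfl | hlt
  · rfl
  · have h1 := (chron_one_iff hom).1 (hc s t has hlt ht)
    have h2 := finslerDist_triangle h hom x (c s) (c t)
    simp only at h1
    linarith

/-- The set below the graph of a Busemann function is the past of the defining curve. -/
theorem pastSetOf_eq_chronPast (hom : IsSmoothOneForm (𝓡 n) om) {a : ℝ} {Ω : EReal} {c : ℝ → M}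
    (haΩ : (a : EReal) < Ω) (hc : IsTimelikeGraph h om a Ω c) {b : M → ℝ}
    (hb : ∀ x : M, Tendsto (fun t : ℝ ↦ t - finslerDist h om x (c t))
      (comap (fun t : ℝ ↦ (t : EReal)) (𝓝[<] Ω)) (𝓝 (b x))) :
    pastSetOf (fun _ ↦ 1) b = chronPast partialT (statMetric h om fun _ ↦ 1)
      {p | ∃ t : ℝ, a ≤ t ∧ (t : EReal) < Ω ∧ p = (t, c t)} := by
  have := neBot_comap_nhdsLT haΩ
  ext p
  simp only [pastSetOf, div_one, intervalIntegral.integral_const, sub_zero, smul_eq_mul, mul_one,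
    mem_ofPred_eq]
  constructor
  · intro hp
    obtain ⟨t, ht, hat, htΩ⟩ :=
      (((hb p.2).eventually (lt_mem_nhds hp)).and (eventually_comap_nhdsLT haΩ)).exists
    exact ⟨(t, c t), ⟨t, hat.le, htΩ, rfl⟩, (chron_one_iff hom).2 (by simp only; linarith)⟩
  · rintro ⟨_, ⟨t, hat, htΩ, rfl⟩, hpt⟩
    have h1 := (chron_one_iff hom).1 hpt
    have h2 : t - finslerDist h om p.2 (c t) ≤ b p.2 := by
      refine ge_of_tendsto (hb p.2) ?_
      filter_upwards [eventually_comap_nhdsLT htΩ] with s hs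
      exact hc.monotone hom p.2 hat hs.1.le hs.2
    simp only at h1
    linarith

omit [ConnectedSpace M] in
theorem IsTimelikeGraph.isIP {a : ℝ} {Ω : EReal} {c : ℝ → M}
    (haΩ : (a : EReal) < Ω) (hc : IsTimelikeGraph h om a Ω c) :
    IsIP partialT (statMetric h om fun _ ↦ 1) (chronPast partialT (statMetric h om fun _ ↦ 1)
      {p | ∃ t : ℝ, a ≤ t ∧ (t : EReal) < Ω ∧ p = (t, c t)}) := by
  have hne : {p : ℝ × M | ∃ t : ℝ, a ≤ t ∧ (t : EReal) < Ω ∧ p = (t, c t)}.Nonempty :=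
    ⟨(a, c a), a, le_rfl, haΩ, rfl⟩
  refine (isPastSet_chronPast (exists_chron_one h om) hne).isIP ?_
  rintro p ⟨_, ⟨s, has, hs, rfl⟩, hp⟩ q ⟨_, ⟨t, hat, ht, rfl⟩, hq⟩
  have hmax : ((max s t : ℝ) : EReal) < Ω := by
    rcases max_choice s t with h' | h' <;> rw [h'] <;> assumption
  obtain ⟨u, hu, hu'⟩ := EReal.lt_iff_exists_real_btwn.1 hmax
  rw [EReal.coe_lt_coe_iff] at hu
  obtain ⟨w, hw, hw'⟩ := EReal.lt_iff_exists_real_btwn.1 hu'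
  rw [EReal.coe_lt_coe_iff] at hw
  have hsu := (le_max_left s t).trans_lt hu
  have htu := (le_max_right s t).trans_lt hu
  exact ⟨(u, c u), ⟨(w, c w), ⟨w, (has.trans hsu.le).trans hw.le, hw', rfl⟩,
    hc u w (has.trans hsu.le) hw hw'⟩, hp.trans (hc s u has hsu hu'),
    hq.trans (hc t u hat htu hu')⟩

theorem IsBusemann.isIP (hom : IsSmoothOneForm (𝓡 n) om) {b : M → ℝ}
    (hb : IsBusemann h om (fun _ ↦ 1) b) :
    IsIP partialT (statMetric h om fun _ ↦ 1) (pastSetOf (fun _ ↦ 1) b) := by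
  obtain ⟨a, Ω, c, haΩ, hc, hlim⟩ := hb
  simp only [div_one, intervalIntegral.integral_const, sub_zero, smul_eq_mul, mul_one] at hc hlim
  have hgraph := isTimelikeGraph_of_piecewiseSmooth hc
  rw [pastSetOf_eq_chronPast hom haΩ hgraph hlim]
  exact hgraph.isIP haΩ

theorem IsBusemann.isIP_add (hom : IsSmoothOneForm (𝓡 n) om) {b : M → ℝ}
    (hb : IsBusemann h om (fun _ ↦ 1) b) (k : ℝ) :
    IsIP partialT (statMetric h om fun _ ↦ 1) (pastSetOf (fun _ ↦ 1) fun x ↦ b x + k) := by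
  convert (hb.isIP hom).translate hom k using 1
  ext p
  simp [pastSetOf, sub_lt_iff_lt_add]

/-- In an indecomposable past set there is a cofinal chronological sequence: by second
countability the set is the union of the pasts of countably many of its points. -/
theorem IsIP.exists_seq [SecondCountableTopology M] (hom : IsSmoothOneForm (𝓡 n) om)
    {P : Set (ℝ × M)} (hP : IsIP partialT (statMetric h om fun _ ↦ 1) P) :
    ∃ q : ℕ → ℝ × M, (∀ k, q k ∈ P) ∧
      (∀ k, Chron partialT (statMetric h om fun _ ↦ 1) (q k) (q (k + 1))) ∧
      ∀ p ∈ P, ∃ k, Chron partialT (statMetric h om fun _ ↦ 1) p (q k) := by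
  obtain ⟨S, hSP, hSc, hS⟩ := TopologicalSpace.isOpen_biUnion_countable P
    (fun r ↦ {p | Chron partialT (statMetric h om fun _ ↦ 1) p r})
    fun r _ ↦ isOpen_chronPast_singleton hom r
  have hcof : ∀ p ∈ P, ∃ r ∈ S, Chron partialT (statMetric h om fun _ ↦ 1) p r := fun p hp ↦ by
    obtain ⟨r, hr, hpr⟩ := hP.1.exists_chron hp
    have : p ∈ ⋃ r ∈ S, {p | Chron partialT (statMetric h om fun _ ↦ 1) p r} := by
      rw [hS]
      exact mem_biUnion hr hpr
    simpa using this
  have hSne : S.Nonempty := by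
    obtain ⟨p, hp⟩ := hP.1.1
    obtain ⟨r, hr, -⟩ := hcof p hp
    exact ⟨r, hr⟩
  obtain ⟨f, rfl⟩ := hSc.exists_eq_range hSne
  have hf : ∀ k, f k ∈ P := fun k ↦ hSP ⟨k, rfl⟩
  choose G hGP hGl hGr using fun p q : P ↦ hP.directed (chron_one_irrefl hom)
    (exists_chron_one h om) p.2 q.2
  let q : ℕ → P := fun k ↦ Nat.rec ⟨f 0, hf 0⟩ (fun k qk ↦ ⟨G qk ⟨f k, hf k⟩, hGP _ _⟩) k
  refine ⟨fun k ↦ (q k).1, fun k ↦ (q k).2, fun k ↦ hGl (q k) ⟨f k, hf k⟩, fun p hp ↦ ?_⟩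
  obtain ⟨_, ⟨k, rfl⟩, hpk⟩ := hcof p hp
  exact ⟨k + 1, hpk.trans (hGr (q k) ⟨f k, hf k⟩)⟩

/-- Every indecomposable past set of `g_cl` except `V` is the set below the graph of a Busemann
function: it is the past of a timelike curve `t ↦ (t, c t)` through a cofinal sequence. -/
theorem IsIP.exists_isBusemann [SecondCountableTopology M] (hom : IsSmoothOneForm (𝓡 n) om)
    {P : Set (ℝ × M)} (hP : IsIP partialT (statMetric h om fun _ ↦ 1) P) (hne : P ≠ univ) :
    ∃ b, IsBusemann h om (fun _ ↦ 1) b ∧ pastSetOf (fun _ ↦ 1) b = P := by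
  obtain ⟨q, hqP, hq, hcof⟩ := hP.exists_seq hom
  have hgc : ∀ k, GraphCurve h om (q k) (q (k + 1)) := fun k ↦
    graphCurve_of_finslerDist_lt hom ((chron_one_iff hom).1 (hq k))
  have ht : StrictMono fun k ↦ (q k).1 := strictMono_nat_of_lt_succ fun k ↦ (hgc k).1
  choose γ hγ hl hr using fun k ↦ (hgc k).2
  obtain ⟨c, hcP, hcx⟩ := exists_piecewiseSmoothWith_of_seq ht hγ hl hr
  set a := (q 0).1
  set Ω : EReal := ⨆ k, (((q k).1 : ℝ) : EReal) with hΩ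
  have hlt : ∀ b : ℝ, (b : EReal) < Ω → ∃ k, b < (q k).1 := fun b hb ↦ by
    obtain ⟨k, hk⟩ := lt_iSup_iff.1 hb
    exact ⟨k, EReal.coe_lt_coe_iff.1 hk⟩
  have htΩ : ∀ k, (((q k).1 : ℝ) : EReal) < Ω := fun k ↦
    (EReal.coe_lt_coe_iff.2 (ht k.lt_succ_self)).trans_le
      (le_iSup (fun k ↦ (((q k).1 : ℝ) : EReal)) (k + 1))
  have hcΩ : ∀ b : ℝ, a < b → (b : EReal) < Ω →
      PiecewiseSmoothWith (𝓡 n) (fun _ x v ↦ finsler h om x v < 1) c a b := fun b _ hb ↦ by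
    obtain ⟨k, hk⟩ := hlt b hb
    exact (hcP k).mono le_rfl hk.le
  have hgraph := isTimelikeGraph_of_piecewiseSmooth hcΩ
  have hmem : ∀ t : ℝ, a ≤ t → (t : EReal) < Ω → (t, c t) ∈ P := fun t hat htΩ' ↦ by
    obtain ⟨k, hk⟩ := hlt t htΩ'
    have := hgraph t (q k).1 hat hk (htΩ k)
    rw [hcx] at this
    exact hP.1.mem_of_chron this (hqP k)
  -- a point outside `P` bounds the monotone functions whose limits are to be taken
  obtain ⟨z, hz⟩ := (ne_univ_iff_exists_notMem P).1 hne
  have hbd : ∀ x, ∀ t : ℝ, a ≤ t → (t : EReal) < Ω →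
      t - finslerDist h om x (c t) ≤ z.1 + finslerDist h om z.2 x := fun x t hat htΩ' ↦ by
    have h1 : ¬ finslerDist h om z.2 (c t) < t - z.1 := fun hlt' ↦
      hz (hP.1.mem_of_chron ((chron_one_iff hom).2 hlt') (hmem t hat htΩ'))
    have h2 := finslerDist_triangle h hom z.2 x (c t)
    linarith [not_lt.1 h1]
  let A : M → Set ℝ := fun x ↦
    (fun t : ℝ ↦ t - finslerDist h om x (c t)) '' {t | a ≤ t ∧ (t : EReal) < Ω}
  have hA : ∀ x, IsLUB (A x) (sSup (A x)) := fun x ↦ isLUB_csSup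
    ⟨_, a, ⟨le_rfl, htΩ 0⟩, rfl⟩
    ⟨z.1 + finslerDist h om z.2 x, by rintro _ ⟨t, ht', rfl⟩; exact hbd x t ht'.1 ht'.2⟩
  have hlim : ∀ x : M, Tendsto (fun t : ℝ ↦ t - finslerDist h om x (c t))
      (comap (fun t : ℝ ↦ (t : EReal)) (𝓝[<] Ω)) (𝓝 (sSup (A x))) := by
    intro x
    refine tendsto_order.2 ⟨fun y hy ↦ ?_, fun y hy ↦ ?_⟩
    · obtain ⟨_, ⟨t, ht', rfl⟩, hyt⟩ := (lt_isLUB_iff (hA x)).1 hy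
      filter_upwards [eventually_comap_nhdsLT ht'.2] with s hs
      exact hyt.trans_le (hgraph.monotone hom x ht'.1 hs.1.le hs.2)
    · filter_upwards [eventually_comap_nhdsLT (htΩ 0)] with s hs
      exact ((hA x).1 ⟨s, ⟨hs.1.le, hs.2⟩, rfl⟩).trans_lt hy
  refine ⟨fun x ↦ sSup (A x), ⟨a, Ω, c, htΩ 0, ?_, ?_⟩, ?_⟩
  · simpa only [div_one] using hcΩ
  · simpa only [div_one, intervalIntegral.integral_const, sub_zero, smul_eq_mul, mul_one]
      using hlim
  · rw [pastSetOf_eq_chronPast hom (htΩ 0) hgraph hlim]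
    apply Subset.antisymm
    · rintro p ⟨_, ⟨t, hat, ht', rfl⟩, hpt⟩
      exact hP.1.mem_of_chron hpt (hmem t hat ht')
    · intro p hp
      obtain ⟨k, hk⟩ := hcof p hp
      exact ⟨q k, ⟨(q k).1, ht.monotone (Nat.zero_le k), htΩ k, Prod.ext rfl (hcx k).symm⟩, hk⟩

theorem pastSetOf_one_injective {X : Type*} :
    Function.Injective (pastSetOf (fun _ ↦ 1) : (X → ℝ) → Set (ℝ × X)) := by
  intro f g hfg
  funext x
  have key : ∀ t : ℝ, t < f x ↔ t < g x := fun t ↦ by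
    have : ((t, x) : ℝ × X) ∈ pastSetOf (fun _ ↦ 1) f ↔ (t, x) ∈ pastSetOf (fun _ ↦ 1) g := by
      rw [hfg]
    simpa [pastSetOf] using this
  exact le_antisymm (le_of_forall_lt fun t ht ↦ (key t).1 ht)
    (le_of_forall_lt fun t ht ↦ (key t).2 ht)

theorem pastSetOf_one_ne_univ {X : Type*} [Nonempty X] (f : X → ℝ) :
    pastSetOf (fun _ ↦ 1) f ≠ (univ : Set (ℝ × X)) := by
  intro heq
  obtain ⟨x⟩ := (inferInstance : Nonempty X)
  have : ((f x, x) : ℝ × X) ∈ pastSetOf (fun _ ↦ 1) f := heq ▸ mem_univ _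
  simp [pastSetOf] at this

/-- The identification of the cone over `M_B⁺` with the future completion of `g_cl`, through a
choice `σ` of one Busemann function in each class. -/
def stationaryCone (σ : BusemannCompletion h om (fun _ ↦ 1) → Busemann h om (fun _ ↦ 1)) :
    Option (ℝ × BusemannCompletion h om (fun _ ↦ 1)) → Set (ℝ × M)
  | none => univ
  | some (s, m) => pastSetOf (fun _ ↦ 1) (fun x ↦ (σ m).1 x + s)

omit [ConnectedSpace M] in
theorem stationaryCone_some (σ : BusemannCompletion h om (fun _ ↦ 1) → Busemann h om (fun _ ↦ 1))
    (s : ℝ) (m : BusemannCompletion h om (fun _ ↦ 1)) :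
    stationaryCone σ (some (s, m)) = pastSetOf (fun _ ↦ 1) (fun x ↦ (σ m).1 x + s) := rfl

omit [ConnectedSpace M] in
theorem stationaryCone_none
    (σ : BusemannCompletion h om (fun _ ↦ 1) → Busemann h om (fun _ ↦ 1)) :
    stationaryCone σ none = univ := rfl

theorem stationaryCone_injective
    {σ : BusemannCompletion h om (fun _ ↦ 1) → Busemann h om (fun _ ↦ 1)}
    (hσ : ∀ m, (σ m).toCompletion = m) : Function.Injective (stationaryCone σ) := by
  rintro (_ | ⟨s, m⟩) (_ | ⟨s', m'⟩) heq
  · rfl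
  · rw [stationaryCone_none, stationaryCone_some] at heq
    exact absurd heq.symm (pastSetOf_one_ne_univ _)
  · rw [stationaryCone_none, stationaryCone_some] at heq
    exact absurd heq (pastSetOf_one_ne_univ _)
  · rw [stationaryCone_some, stationaryCone_some] at heq
    have hfun := pastSetOf_one_injective heq
    have hm : m = m' := by
      rw [← hσ m, ← hσ m']
      exact Quotient.sound ⟨s - s', fun x ↦ by linarith [congrFun hfun x]⟩
    subst hm
    obtain ⟨x⟩ := (inferInstance : Nonempty M)
    have hs : s = s' := by linarith [congrFun hfun x]
    rw [hs]

theorem range_stationaryCone [SecondCountableTopology M] (hom : IsSmoothOneForm (𝓡 n) om)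
    {σ : BusemannCompletion h om (fun _ ↦ 1) → Busemann h om (fun _ ↦ 1)}
    (hσ : ∀ m, (σ m).toCompletion = m) :
    range (stationaryCone σ) = futureCompletion partialT (statMetric h om fun _ ↦ 1) := by
  apply Subset.antisymm
  · rintro _ ⟨_ | ⟨s, m⟩, rfl⟩
    · exact isIP_univ h hom
    · exact (σ m).2.isIP_add hom s
  · intro P hP
    by_cases hne : P = univ
    · exact ⟨none, hne.symm⟩
    · obtain ⟨b, hb, rfl⟩ := IsIP.exists_isBusemann hom hP hne
      set m := Busemann.toCompletion ⟨b, hb⟩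
      obtain ⟨K, hK⟩ := Quotient.exact (hσ m)
      refine ⟨some (K, m), ?_⟩
      rw [stationaryCone_some]
      congr 1
      funext x
      exact (hK x).symm

theorem coneMap_eq_chronPast {D : SplitSpacetime n M} (hom : IsSmoothOneForm (𝓡 n) om)
    (hcl : ConesWider partialT (statMetric h om fun _ ↦ 1) D.metric)
    (σ : BusemannCompletion h om (fun _ ↦ 1) → Busemann h om (fun _ ↦ 1))
    (z : Option (ℝ × BusemannCompletion h om (fun _ ↦ 1))) :
    coneMap D.metric σ z = chronPast partialT D.metric (stationaryCone σ z) := by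
  rcases z with _ | ⟨s, m⟩
  · refine (eq_univ_of_forall fun p ↦ ?_).symm
    obtain ⟨q, hq, hpq⟩ := (isIP_univ h hom).1.exists_chron (mem_univ p)
    exact ⟨q, hq, D.chron_of_chron_one hcl hpq⟩
  · rfl

end Main

end IsoCausal

theorem mainTheorem3 {n : ℕ} {M : Type*} [TopologicalSpace M]
    [ChartedSpace (EuclideanSpace ℝ (Fin n)) M] [IsManifold (𝓡 n) ∞ M]
    [T2Space M] [SecondCountableTopology M] [ConnectedSpace M]
    (h : IsoCausal.RMetric n M)
    (om : IsoCausal.LinField (𝓡 n) M) (hom : IsoCausal.IsSmoothOneForm (𝓡 n) om)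
    (α : ℝ → ℝ) (hα : ContDiff ℝ ∞ α) (hα_pos : ∀ t, 0 < α t)
    (D : IsoCausal.SplitSpacetime n M)
    (hcl : IsoCausal.ConesWider IsoCausal.partialT
      (IsoCausal.statMetric h om (fun _ ↦ 1)) D.metric)
    (hop : IsoCausal.ConesWider IsoCausal.partialT
      D.metric (IsoCausal.statMetric h om α))
    (hint : MeasureTheory.IntegrableOn (fun s ↦ 1 / α s - 1) (Ioi 0)) :
    MapsTo (IsoCausal.chronPast IsoCausal.partialT D.metric)
      (IsoCausal.futureCompletion IsoCausal.partialT
        (IsoCausal.statMetric h om (fun _ ↦ 1)))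
      (IsoCausal.futureCompletion IsoCausal.partialT D.metric) ∧
    InjOn (IsoCausal.chronPast IsoCausal.partialT D.metric)
      (IsoCausal.futureCompletion IsoCausal.partialT
        (IsoCausal.statMetric h om (fun _ ↦ 1))) ∧
    ∀ σ : IsoCausal.BusemannCompletion h om (fun _ ↦ 1) → IsoCausal.Busemann h om (fun _ ↦ 1),
      (∀ m, (σ m).toCompletion = m) →
      (∀ z, IsoCausal.coneMap D.metric σ z ∈
        IsoCausal.futureCompletion IsoCausal.partialT D.metric) ∧
      Function.Injective (IsoCausal.coneMap D.metric σ) ∧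
      range (IsoCausal.coneMap D.metric σ) =
        IsoCausal.chronPast IsoCausal.partialT D.metric ''
          IsoCausal.futureCompletion IsoCausal.partialT
            (IsoCausal.statMetric h om (fun _ ↦ 1)) := by
  have hmaps : MapsTo (IsoCausal.chronPast IsoCausal.partialT D.metric)
      (IsoCausal.futureCompletion IsoCausal.partialT (IsoCausal.statMetric h om (fun _ ↦ 1)))
      (IsoCausal.futureCompletion IsoCausal.partialT D.metric) :=
    fun P hP ↦ IsoCausal.IsIP.isIP_chronPast hom hcl hP
  have hinj : InjOn (IsoCausal.chronPast IsoCausal.partialT D.metric)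
      (IsoCausal.futureCompletion IsoCausal.partialT
        (IsoCausal.statMetric h om (fun _ ↦ 1))) := fun P hP Q hQ hPQ ↦
    Subset.antisymm
      (hP.subset_of_chronPast_eq hom hα.continuous hα_pos hcl hop hint hQ hPQ)
      (hQ.subset_of_chronPast_eq hom hα.continuous hα_pos hcl hop hint hP hPQ.symm)
  refine ⟨hmaps, hinj, fun σ hσ ↦ ?_⟩
  have hrange := IsoCausal.range_stationaryCone hom hσ
  have hmem : ∀ z, IsoCausal.stationaryCone σ z ∈ IsoCausal.futureCompletion IsoCausal.partialT
      (IsoCausal.statMetric h om (fun _ ↦ 1)) := fun z ↦ hrange ▸ mem_range_self z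
  have hcone := IsoCausal.coneMap_eq_chronPast hom hcl σ
  refine ⟨fun z ↦ ?_, fun z z' hzz' ↦ ?_, ?_⟩
  · rw [hcone]
    exact hmaps (hmem z)
  · rw [hcone, hcone] at hzz'
    exact IsoCausal.stationaryCone_injective hσ (hinj (hmem z) (hmem z') hzz')
  · rw [← hrange, ← range_comp]
    exact congrArg range (funext hcone)
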